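/- Let $\mathfrak h$ be a complex Hilbert space and let $\mathfrak C_1^{\rm sa}$ be the real Banach space of all self-adjoint trace-class operators on $\mathfrak h$, with the trace norm $\|u\|=\operatorname{Tr}|u|$. Write $u\ge 0$ if $(ux,x)\ge 0$ for all $x\in\mathfrak h$; a linear operator $A\colon D(A)\to\mathfrak C_1^{\rm sa}$ with $D(A)\subset\mathfrak C_1^{\rm sa}$ is called positivity preserving if $Au\ge 0$ for all $u\in D(A)$ with $u\ge 0$, and a semigroup $(S_t)_{t>0}$ is called positivity preserving if every $S_t$ is. Put $D(A)^+=\{u\in D(A):u\ge 0\}$. An operator $A$ in $\mathfrak C_1^{\rm sa}$ is called $m$-accretive if it is densely defined and if for all $\lambda>0$ the map $\lambda I+A\colon D(A)\to\mathfrak C_1^{\rm sa}$ is bijective with $\|(\lambda I+A)^{-1}\|\le\lambda^{-1}$; it is called quasi-$m$-accretive if $\omega I+A$ is $m$-accretive for some $\omega\in\mathbb R$. Let $-H$ be the generator of a positivity preserving contraction $C_0$-semigroup on $\mathfrak C_1^{\rm sa}$, and let $K\colon D(H)\to\mathfrak C_1^{\rm sa}$ be a positivity preserving linear operator. Suppose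 there exist $a\in[0,\infty)$ and $b\in[0,1)$ such that $$\operatorname{Tr}(Ku)\le a\operatorname{Tr}u+b\operatorname{Tr}(Hu)\qquad\text{for all }u\in D(H)^+.$$ Define $L=H-K$ with domain $D(L)=D(H)$. Then the following hold. (a) The operator $L$ is quasi-$m$-accretive, and $-L$ generates a $C_0$-semigroup which is positivity preserving. (b) If in addition $\operatorname{Tr}(Ku)\le\operatorname{Tr}(Hu)$ for all $u\in D(H)^+$, then $L$ is $m$-accretive, and the semigroup generated by $-L$ is a contraction semigroup. (c) If again $\operatorname{Tr}(Ku)\le\operatorname{Tr}(Hu)$ for all $u\in D(H)^+$, then for all $\lambda>0$ the operators $\lambda I+H$ and $\lambda I+L$ are invertible, and for all $u\in\mathfrak C_1^{\rm sa}$ $$\lim_{N\to\infty}\sum_{n=0}^N(\lambda I+H)^{-1}\bigl(K(\lambda I+H)^{-1}\bigr)^n u=(\lambda I+L)^{-1}u$$ in the trace norm. -/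

import Mathlib

open Filter Topology
open scoped NNReal ENNReal

noncomputable section

namespace TraceClass

variable {E : Type*} [NormedAddCommGroup E] [InnerProductSpace ℂ E] [CompleteSpace E]

/-! ### The trace of positive operators -/

/-- The index set of a fixed Hilbert basis of `E`. -/
def basisIndex (E : Type*) [NormedAddCommGroup E] [InnerProductSpace ℂ E] [CompleteSpace E] :
    Set E :=
  (exists_hilbertBasis ℂ E).choose

/-- A fixed Hilbert basis of `E`; the trace does not depend on it. -/
def stdBasis (E : Type*) [NormedAddCommGroup E] [InnerProductSpace ℂ E] [CompleteSpace E] :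
    HilbertBasis (basisIndex E) ℂ E :=
  (exists_hilbertBasis ℂ E).choose_spec.choose

/-- The trace of a positive operator, with values in `[0, ∞]`. -/
def posTrace (u : E →L[ℂ] E) : ℝ≥0∞ :=
  ∑' i, ENNReal.ofReal (inner ℂ (stdBasis E i) (u (stdBasis E i))).re

theorem ofReal_norm_sq_eq_tsum {ι : Type*} (b : HilbertBasis ι ℂ E) (x : E) :
    ENNReal.ofReal (‖x‖ ^ 2) = ∑' i, ENNReal.ofReal (‖inner ℂ (b i) x‖ ^ 2) := by
  have h := b.hasSum_inner_mul_inner x x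
  have h2 : HasSum (fun i => ‖inner ℂ (b i) x‖ ^ 2) (‖x‖ ^ 2) := by
    have h3 := Complex.hasSum_re h
    rw [inner_self_eq_norm_sq_to_K] at h3
    convert h3 using 1
    · ext i
      rw [← inner_conj_symm x (b i), mul_comm, Complex.mul_conj, Complex.ofReal_re,
        Complex.normSq_eq_norm_sq]
    · norm_cast
  rw [← h2.tsum_eq, ENNReal.ofReal_tsum_of_nonneg (fun _ => by positivity) h2.summable]

theorem inner_eq_norm_sqrt_sq {u : E →L[ℂ] E} (hu : 0 ≤ u) (x : E) :
    (inner ℂ x (u x)).re = ‖CFC.sqrt u x‖ ^ 2 := by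
  have hs : IsSelfAdjoint (CFC.sqrt u) := IsSelfAdjoint.of_nonneg (CFC.sqrt_nonneg u)
  have h1 : u x = CFC.sqrt u (CFC.sqrt u x) := by
    conv_lhs => rw [← CFC.sqrt_mul_sqrt_self u hu]
    rfl
  rw [h1, ← ContinuousLinearMap.adjoint_inner_left, hs.adjoint_eq, inner_self_eq_norm_sq_to_K]
  norm_cast

/-- The trace of a positive operator may be computed in every Hilbert basis. -/
theorem posTrace_eq_tsum {u : E →L[ℂ] E} (hu : 0 ≤ u) {ι : Type*} (b : HilbertBasis ι ℂ E) :
    posTrace u = ∑' i, ENNReal.ofReal (inner ℂ (b i) (u (b i))).re := by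
  have hs : IsSelfAdjoint (CFC.sqrt u) := IsSelfAdjoint.of_nonneg (CFC.sqrt_nonneg u)
  unfold posTrace
  simp_rw [inner_eq_norm_sqrt_sq hu]
  simp_rw [ofReal_norm_sq_eq_tsum b (CFC.sqrt u (stdBasis E _)),
    ofReal_norm_sq_eq_tsum (stdBasis E) (CFC.sqrt u (b _))]
  rw [ENNReal.tsum_comm]
  refine tsum_congr fun j => tsum_congr fun i => ?_
  rw [← ContinuousLinearMap.adjoint_inner_left, hs.adjoint_eq, norm_inner_symm]

theorem re_inner_nonneg {u : E →L[ℂ] E} (hu : 0 ≤ u) (x : E) : 0 ≤ (inner ℂ x (u x)).re := by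
  rw [inner_eq_norm_sqrt_sq hu]; positivity

theorem posTrace_add {u v : E →L[ℂ] E} (hu : 0 ≤ u) (hv : 0 ≤ v) :
    posTrace (u + v) = posTrace u + posTrace v := by
  unfold posTrace
  rw [← ENNReal.tsum_add]
  refine tsum_congr fun i => ?_
  rw [add_apply, inner_add_right, Complex.add_re,
    ENNReal.ofReal_add (re_inner_nonneg hu _) (re_inner_nonneg hv _)]

theorem posTrace_smul {c : ℝ} (hc : 0 ≤ c) (u : E →L[ℂ] E) :
    posTrace (c • u) = ENNReal.ofReal c * posTrace u := by
  unfold posTrace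
  rw [← ENNReal.tsum_mul_left]
  refine tsum_congr fun i => ?_
  rw [smul_apply, inner_smul_right_eq_smul, Complex.smul_re, smul_eq_mul,
    ENNReal.ofReal_mul hc]

theorem eq_zero_of_posTrace_eq_zero {u : E →L[ℂ] E} (hu : 0 ≤ u) (h : posTrace u = 0) :
    u = 0 := by
  unfold posTrace at h
  rw [ENNReal.tsum_eq_zero] at h
  have h1 : ∀ i, CFC.sqrt u (stdBasis E i) = 0 := fun i => by
    have h2 := h i
    rw [inner_eq_norm_sqrt_sq hu, ENNReal.ofReal_eq_zero] at h2
    exact norm_eq_zero.1 (pow_eq_zero_iff two_ne_zero |>.1 (le_antisymm h2 (by positivity)))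
  have h3 : CFC.sqrt u = 0 := by
    refine ContinuousLinearMap.ext_on (s := Set.range (stdBasis E)) ?_ ?_
    · rw [Submodule.dense_iff_topologicalClosure_eq_top]
      exact (stdBasis E).dense_span
    · rintro _ ⟨i, rfl⟩
      simpa using h1 i
  rw [← CFC.sqrt_mul_sqrt_self u hu, h3, zero_mul]

/-- The trace of `|u|` is minimal among the traces `Tr v + Tr w` with `u = v - w`. -/
theorem posTrace_abs_le {u v w : E →L[ℂ] E} (hu : IsSelfAdjoint u) (hv : 0 ≤ v) (hw : 0 ≤ w)
    (h : u = v - w) : posTrace (CFC.abs u) ≤ posTrace v + posTrace w := by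
  have hp : IsSelfAdjoint u⁺ := IsSelfAdjoint.of_nonneg (CFC.posPart_nonneg u)
  have hn : IsSelfAdjoint u⁻ := IsSelfAdjoint.of_nonneg (CFC.negPart_nonneg u)
  set M : Submodule ℂ E := LinearMap.ker (u⁺ : E →L[ℂ] E).toLinearMap with hM
  have hMc : IsClosed (M : Set E) := (u⁺ : E →L[ℂ] E).isClosed_ker
  have : CompleteSpace M := hMc.completeSpace_coe
  obtain ⟨s, bM, hbM⟩ := exists_hilbertBasis ℂ M
  have hs : Orthonormal ℂ ((↑) : (M.subtype '' s) → E) := by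
    have h1 : Orthonormal ℂ (fun x : s => ((x : M) : E)) := by
      have h2 := bM.orthonormal
      rw [hbM] at h2
      exact h2.comp_linearIsometry M.subtypeₗᵢ
    have h3 := h1.toSubtypeRange
    have h4 : Set.range (fun x : s => ((x : M) : E)) = M.subtype '' s := by
      ext x; simp
    rw [h4] at h3
    exact h3
  obtain ⟨t, b, hst, hb⟩ := hs.exists_hilbertBasis_extension
  have hmem : ∀ i : t, (b i) ∈ M ∨ (b i) ∈ Mᗮ := by
    intro i
    by_cases hi : (i : E) ∈ M.subtype '' s
    · left
      obtain ⟨m, -, hm⟩ := hi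
      rw [hb, ← hm]
      exact m.2
    · right
      rw [Submodule.mem_orthogonal]
      intro y hy
      have key : ∀ m : M, inner ℂ (m : E) (b i) = 0 := by
        let f : M →L[ℂ] ℂ := (innerSL ℂ (b i)).comp M.subtypeL
        have hf : f = 0 := by
          refine ContinuousLinearMap.ext_on (s := Set.range bM) ?_ ?_
          · rw [Submodule.dense_iff_topologicalClosure_eq_top]
            exact bM.dense_span
          · rintro _ ⟨j, rfl⟩
            have hj : ((bM j : M) : E) ∈ t := hst ⟨bM j, by rw [hbM]; exact j.2, rfl⟩
            have hne : i ≠ ⟨_, hj⟩ := by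
              intro hij
              apply hi
              rw [hij]
              exact ⟨bM j, by rw [hbM]; exact j.2, rfl⟩
            have h5 : inner ℂ (b i) (b ⟨_, hj⟩) = 0 := b.orthonormal.2 hne
            have h6 : b ⟨_, hj⟩ = ((bM j : M) : E) := by rw [hb]
            rw [h6] at h5
            simpa [f] using h5
        intro m
        have h7 : f m = 0 := by rw [hf]; rfl
        have h8 : inner ℂ (b i) (m : E) = 0 := by simpa [f] using h7
        rw [← inner_conj_symm, h8, map_zero]
      exact key ⟨y, hy⟩
  rw [posTrace_eq_tsum (CFC.abs_nonneg u) b, posTrace_eq_tsum hv b, posTrace_eq_tsum hw b,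
    ← ENNReal.tsum_add]
  refine ENNReal.tsum_le_tsum fun i => ?_
  rw [← ENNReal.ofReal_add (re_inner_nonneg hv _) (re_inner_nonneg hw _)]
  apply ENNReal.ofReal_le_ofReal
  have hv' := re_inner_nonneg hv (b i)
  have hw' := re_inner_nonneg hw (b i)
  have hsum : CFC.abs u = u⁺ + u⁻ := (CFC.posPart_add_negPart u hu).symm
  have hdiff : u⁺ - u⁻ = v - w := by rw [CFC.posPart_sub_negPart u hu, h]
  have hdiff' : (u⁺ : E →L[ℂ] E) (b i) - (u⁻ : E →L[ℂ] E) (b i) = v (b i) - w (b i) := by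
    rw [← sub_apply, hdiff, sub_apply]
  rw [hsum, add_apply]
  rcases hmem i with hi | hi
  · have h0 : (u⁺ : E →L[ℂ] E) (b i) = 0 := hi
    have h9 : (u⁻ : E →L[ℂ] E) (b i) = w (b i) - v (b i) := by
      rw [h0, zero_sub] at hdiff'
      rw [← neg_sub, ← hdiff', neg_neg]
    rw [h0, zero_add, h9, inner_sub_right, Complex.sub_re]
    linarith
  · have h0 : (u⁻ : E →L[ℂ] E) (b i) = 0 := by
      rw [← norm_eq_zero, ← sq_eq_zero_iff, ← inner_self_eq_norm_sq (𝕜 := ℂ),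
        ← ContinuousLinearMap.adjoint_inner_left, hn.adjoint_eq]
      have : (u⁻ : E →L[ℂ] E) ((u⁻ : E →L[ℂ] E) (b i)) ∈ M := by
        change ((u⁺ : E →L[ℂ] E) * u⁻) ((u⁻ : E →L[ℂ] E) (b i)) = 0
        rw [CFC.posPart_mul_negPart]; rfl
      rw [Submodule.inner_right_of_mem_orthogonal this hi, map_zero]
    rw [h0, sub_zero] at hdiff'
    rw [h0, add_zero, hdiff', inner_sub_right, Complex.sub_re]
    linarith

/-! ### The real Banach space of self-adjoint trace-class operators -/

/-- A bounded operator `u` is of trace class if `Tr |u| < ∞`, where `|u| = (u* u)^(1/2)`. -/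
def IsTraceClass (u : E →L[ℂ] E) : Prop :=
  posTrace (CFC.abs u) < ∞

theorem posTrace_abs_add_le {u v : E →L[ℂ] E} (hu : IsSelfAdjoint u) (hv : IsSelfAdjoint v) :
    posTrace (CFC.abs (u + v)) ≤ posTrace (CFC.abs u) + posTrace (CFC.abs v) := by
  have h1 : u + v = (u⁺ + v⁺) - (u⁻ + v⁻) := by
    conv_lhs => rw [← CFC.posPart_sub_negPart u hu, ← CFC.posPart_sub_negPart v hv]
    abel
  have hup := CFC.posPart_nonneg u
  have hun := CFC.negPart_nonneg u
  have hvp := CFC.posPart_nonneg v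
  have hvn := CFC.negPart_nonneg v
  refine (posTrace_abs_le (hu.add hv) (add_nonneg hup hvp) (add_nonneg hun hvn) h1).trans ?_
  rw [← CFC.posPart_add_negPart u hu, ← CFC.posPart_add_negPart v hv, posTrace_add hup hvp,
    posTrace_add hun hvn, posTrace_add hup hun, posTrace_add hvp hvn]
  apply le_of_eq
  abel

theorem posTrace_abs_smul (c : ℝ) (u : E →L[ℂ] E) :
    posTrace (CFC.abs (c • u)) = ENNReal.ofReal |c| * posTrace (CFC.abs u) := by
  rw [CFC.abs_smul, Real.norm_eq_abs, posTrace_smul (abs_nonneg c)]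

/-- The real subspace of self-adjoint trace-class operators. -/
def selfAdjointSubmodule (E : Type*) [NormedAddCommGroup E] [InnerProductSpace ℂ E]
    [CompleteSpace E] : Submodule ℝ (E →L[ℂ] E) where
  carrier := {u | IsSelfAdjoint u ∧ IsTraceClass u}
  add_mem' hu hv := ⟨hu.1.add hv.1,
    (posTrace_abs_add_le hu.1 hv.1).trans_lt (ENNReal.add_lt_top.2 ⟨hu.2, hv.2⟩)⟩
  zero_mem' := ⟨IsSelfAdjoint.zero _, by simp [IsTraceClass, posTrace]⟩
  smul_mem' c u hu := ⟨(IsSelfAdjoint.all c).smul hu.1, by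
    unfold IsTraceClass
    rw [posTrace_abs_smul]
    exact ENNReal.mul_lt_top ENNReal.ofReal_lt_top hu.2⟩

end TraceClass

/-- The space `𝔠₁ˢᵃ` of self-adjoint trace-class operators on the complex Hilbert space `E`, a real
vector space which is given the trace norm below. -/
def TraceClassSA (E : Type*) [NormedAddCommGroup E] [InnerProductSpace ℂ E] [CompleteSpace E] :
    Type _ :=
  TraceClass.selfAdjointSubmodule E

namespace TraceClassSA

open TraceClass

variable {E : Type*} [NormedAddCommGroup E] [InnerProductSpace ℂ E] [CompleteSpace E]

instance : AddCommGroup (TraceClassSA E) :=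
  inferInstanceAs (AddCommGroup (TraceClass.selfAdjointSubmodule E))

instance : Module ℝ (TraceClassSA E) :=
  inferInstanceAs (Module ℝ (TraceClass.selfAdjointSubmodule E))

/-- The underlying bounded operator. -/
def toOp : TraceClassSA E →ₗ[ℝ] (E →L[ℂ] E) :=
  (TraceClass.selfAdjointSubmodule E).subtype

theorem toOp_injective : Function.Injective (toOp (E := E)) :=
  Subtype.val_injective

theorem isSelfAdjoint_toOp (u : TraceClassSA E) : IsSelfAdjoint (toOp u) :=
  u.2.1

theorem isTraceClass_toOp (u : TraceClassSA E) : IsTraceClass (toOp u) :=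
  u.2.2

/-- The trace norm `‖u‖ = Tr |u|`. -/
instance : Norm (TraceClassSA E) :=
  ⟨fun u => (posTrace (CFC.abs (toOp u))).toReal⟩

theorem norm_def (u : TraceClassSA E) : ‖u‖ = (posTrace (CFC.abs (toOp u))).toReal :=
  rfl

theorem normedSpaceCore : NormedSpace.Core ℝ (TraceClassSA E) where
  norm_nonneg _ := ENNReal.toReal_nonneg
  norm_smul c u := by
    rw [norm_def, norm_def, map_smul, posTrace_abs_smul, ENNReal.toReal_mul,
      ENNReal.toReal_ofReal (abs_nonneg c), Real.norm_eq_abs]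
  norm_triangle u v := by
    rw [norm_def, norm_def, norm_def, map_add,
      ← ENNReal.toReal_add (isTraceClass_toOp u).ne (isTraceClass_toOp v).ne]
    exact ENNReal.toReal_mono
      (ENNReal.add_lt_top.2 ⟨isTraceClass_toOp u, isTraceClass_toOp v⟩).ne
      (posTrace_abs_add_le (isSelfAdjoint_toOp u) (isSelfAdjoint_toOp v))
  norm_eq_zero_iff u := by
    constructor
    · intro h
      rw [norm_def, ENNReal.toReal_eq_zero_iff] at h
      have h1 := h.resolve_right (isTraceClass_toOp u).ne
      apply toOp_injective
      rw [map_zero]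
      exact CFC.abs_eq_zero_iff.1 (eq_zero_of_posTrace_eq_zero (CFC.abs_nonneg _) h1)
    · rintro rfl
      rw [norm_def, map_zero, CFC.abs_zero]
      simp [posTrace]

instance : NormedAddCommGroup (TraceClassSA E) :=
  NormedAddCommGroup.ofCore normedSpaceCore

instance : NormedSpace ℝ (TraceClassSA E) :=
  NormedSpace.ofCore normedSpaceCore

/-- The trace `Tr u` of a self-adjoint trace-class operator, a real number. -/
def trace (u : TraceClassSA E) : ℝ :=
  ∑' i, (inner ℂ (stdBasis E i) (toOp u (stdBasis E i))).re

/-- `u ≥ 0`, that is, `(u x, x) ≥ 0` for all `x`. -/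
def Nonneg (u : TraceClassSA E) : Prop :=
  (toOp u).IsPositive

theorem hasSum_re_inner_of_nonneg {v : E →L[ℂ] E} (hv : 0 ≤ v) (hv' : posTrace v < ∞)
    {ι : Type*} (b : HilbertBasis ι ℂ E) :
    HasSum (fun i => (inner ℂ (b i) (v (b i))).re) (posTrace v).toReal := by
  have h1 := posTrace_eq_tsum hv b
  have h2 := ENNReal.hasSum_toReal (h1 ▸ hv'.ne)
  rw [← ENNReal.tsum_toReal_eq (fun i => ENNReal.ofReal_ne_top), ← h1] at h2
  simpa only [ENNReal.toReal_ofReal (re_inner_nonneg hv _)] using h2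

theorem hasSum_re_inner (u : TraceClassSA E) {ι : Type*} (b : HilbertBasis ι ℂ E) :
    HasSum (fun i => (inner ℂ (b i) (toOp u (b i))).re)
      ((posTrace (toOp u)⁺).toReal - (posTrace (toOp u)⁻).toReal) := by
  have hsa := isSelfAdjoint_toOp u
  have hp := CFC.posPart_nonneg (toOp u)
  have hn := CFC.negPart_nonneg (toOp u)
  have hfin := isTraceClass_toOp u
  unfold IsTraceClass at hfin
  rw [← CFC.posPart_add_negPart _ hsa, posTrace_add hp hn, ENNReal.add_lt_top] at hfin
  have key := (hasSum_re_inner_of_nonneg hp hfin.1 b).sub (hasSum_re_inner_of_nonneg hn hfin.2 b)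
  have heq : (fun i => (inner ℂ (b i) (toOp u (b i))).re) = fun i =>
      (inner ℂ (b i) ((toOp u)⁺ (b i))).re - (inner ℂ (b i) ((toOp u)⁻ (b i))).re := by
    funext i
    rw [← Complex.sub_re, ← inner_sub_right, ← sub_apply, CFC.posPart_sub_negPart _ hsa]
  rw [heq]
  exact key

/-- The series that defines the trace converges, to the same sum in every Hilbert basis. -/
theorem hasSum_trace (u : TraceClassSA E) {ι : Type*} (b : HilbertBasis ι ℂ E) :
    HasSum (fun i => (inner ℂ (b i) (toOp u (b i))).re) (trace u) := by
  have h : trace u = (posTrace (toOp u)⁺).toReal - (posTrace (toOp u)⁻).toReal :=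
    (hasSum_re_inner u (stdBasis E)).tsum_eq
  rw [h]
  exact hasSum_re_inner u b

end TraceClassSA

/-! ### Linear operators and `C₀`-semigroups on a real Banach space -/

namespace LinearPMap

variable {X : Type*} [NormedAddCommGroup X] [NormedSpace ℝ X]

/-- The operator `λ I + A` on the domain of `A`. -/
def shift (A : X →ₗ.[ℝ] X) (lam : ℝ) : A.domain →ₗ[ℝ] X :=
  lam • A.domain.subtype + A.toFun

/-- The inverse `(λ I + A)⁻¹`, as a map onto the domain of `A`, if `λ I + A` is invertible. -/
def resolvent (A : X →ₗ.[ℝ] X) (lam : ℝ) (h : Function.Bijective (A.shift lam)) :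
    X →ₗ[ℝ] A.domain :=
  (LinearEquiv.ofBijective (A.shift lam) h).symm

/-- `A` is m-accretive: it is densely defined, and for all `λ > 0` the operator `λ I + A` is
invertible with `‖(λ I + A)⁻¹‖ ≤ λ⁻¹`. -/
def IsMAccretive (A : X →ₗ.[ℝ] X) : Prop :=
  Dense (A.domain : Set X) ∧
    ∀ lam : ℝ, 0 < lam → ∃ h : Function.Bijective (A.shift lam),
      ∀ u : X, ‖(A.resolvent lam h u : X)‖ ≤ lam⁻¹ * ‖u‖

/-- `A` is quasi-m-accretive: `ω I + A` is m-accretive for some real `ω`. -/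
def IsQuasiMAccretive (A : X →ₗ.[ℝ] X) : Prop :=
  ∃ ω : ℝ, IsMAccretive (⟨A.domain, A.shift ω⟩ : X →ₗ.[ℝ] X)

end LinearPMap

/-- A `C₀`-semigroup of bounded operators on `X`. -/
structure IsC0Semigroup {X : Type*} [NormedAddCommGroup X] [NormedSpace ℝ X]
    (T : ℝ≥0 → X →L[ℝ] X) : Prop where
  zero : T 0 = ContinuousLinearMap.id ℝ X
  add : ∀ s t : ℝ≥0, T (s + t) = (T s).comp (T t)
  tendsto : ∀ u : X, Tendsto (fun t => T t u) (𝓝[>] 0) (𝓝 u)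

/-- `A` is the generator of `T`: `u` is in the domain of `A` and `A u = v` if and only if
`t⁻¹ (T_t u - u)` converges to `v` as `t ↓ 0`. -/
def IsGenerator {X : Type*} [NormedAddCommGroup X] [NormedSpace ℝ X]
    (T : ℝ≥0 → X →L[ℝ] X) (A : X →ₗ.[ℝ] X) : Prop :=
  ∀ u v : X, (u, v) ∈ A.graph ↔
    Tendsto (fun t : ℝ≥0 => (t : ℝ)⁻¹ • (T t u - u)) (𝓝[>] 0) (𝓝 v)

/-- The operators `T_t` are contractions. -/
def IsContractive {X : Type*} [NormedAddCommGroup X] [NormedSpace ℝ X]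
    (T : ℝ≥0 → X →L[ℝ] X) : Prop :=
  ∀ t, ‖T t‖ ≤ 1

/-- The operators `T_t` map positive trace-class operators to positive ones. -/
def IsPositivityPreservingSemigroup {E : Type*} [NormedAddCommGroup E] [InnerProductSpace ℂ E]
    [CompleteSpace E] (T : ℝ≥0 → TraceClassSA E →L[ℝ] TraceClassSA E) : Prop :=
  ∀ t u, TraceClassSA.Nonneg u → TraceClassSA.Nonneg (T t u)

/-- The operator `A : D → 𝔠₁ˢᵃ` maps the positive elements of its domain to positive ones. -/
def IsPositivityPreserving {E : Type*} [NormedAddCommGroup E] [InnerProductSpace ℂ E]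
    [CompleteSpace E] {D : Submodule ℝ (TraceClassSA E)} (A : D →ₗ[ℝ] TraceClassSA E) : Prop :=
  ∀ u : D, TraceClassSA.Nonneg (u : TraceClassSA E) → TraceClassSA.Nonneg (A u)

end

/-! The trace norm is additive on positive operators, where it equals the trace, and each `u` splits
as `p - q` with `p, q ≥ 0` and `‖p‖ + ‖q‖ = ‖u‖`. Only this structure, together with completeness,
enters the perturbation argument, which is therefore stated for an abstract cone (`IsBaseNormCone`).

Put `R = (λ + H)⁻¹` and `P = K R`; both are positive, and `λ + L = (I - P)(λ + H)`. The operator `P`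
need not have norm below `1`, so a geometric bound is not at hand. Instead, for `u ≥ 0` let `s` be a
partial sum of `∑ R Pⁿ u`. Telescoping gives `(λ + H) s = u - Pᴺ u + K s`. In traces this bounds `Tr
s` and `Tr (H s)`, and the relative bound with `b < 1` then absorbs `Tr (K s) = ∑ ‖Pⁿ⁺¹ u‖`
(`sum_norm_pow_resolvent_le`). So `∑ Pⁿ u` converges absolutely for every `u`, which yields the
inverse of `λ + L`, its positivity and the series in (c) (`exists_resolvent_sub`). Its norm is at
most `κ⁻¹` when `κ Tr x ≤ Tr ((λ + L) x)` on the cone.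

Since `Tr (H x) ≥ 0` for `x ≥ 0`, the choice `κ = λ` works for `a + L`, and for `L` itself under the
extra hypothesis. Hille–Yosida, with bounded approximations that preserve the cone, produces the
semigroup; the factor `exp (a t)` undoes the shift. -/

/-- The norm of `X` is a base norm with respect to the closed cone `C`, with the linear functional
`τ`: the norm equals `τ` on `C`, and it is attained on decompositions into differences of elements
of `C`. -/
structure IsBaseNormCone {X : Type*} [NormedAddCommGroup X] [NormedSpace ℝ X]
    (C : PointedCone ℝ X) (τ : X →ₗ[ℝ] ℝ) : Prop where
  isClosed : IsClosed (C : Set X)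
  norm_eq : ∀ u ∈ C, ‖u‖ = τ u
  exists_sub : ∀ u, ∃ p ∈ C, ∃ q ∈ C, u = p - q ∧ ‖p‖ + ‖q‖ = ‖u‖

/-! ### Traces of positive operators: domination of the operator norm and countable additivity. -/

namespace TraceClass

variable {E : Type*} [NormedAddCommGroup E] [InnerProductSpace ℂ E] [CompleteSpace E]

/-- The trace of a positive operator dominates its operator norm. -/
theorem ofReal_norm_le_posTrace {u : E →L[ℂ] E} (hu : 0 ≤ u) :
    ENNReal.ofReal ‖u‖ ≤ posTrace u := by
  rcases eq_or_ne (posTrace u) ∞ with h | h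
  · simp [h]
  have hs : IsSelfAdjoint (CFC.sqrt u) := IsSelfAdjoint.of_nonneg (CFC.sqrt_nonneg u)
  -- The trace of `u` is the squared Hilbert–Schmidt norm of `√u`: each coefficient `⟨eᵢ, √u x⟩ =
  -- ⟨√u eᵢ, x⟩` is bounded by Cauchy–Schwarz and the squares are summed.
  have key : ∀ x, ‖CFC.sqrt u x‖ ^ 2 ≤ (posTrace u).toReal * ‖x‖ ^ 2 := by
    intro x
    have h1 : ENNReal.ofReal (‖CFC.sqrt u x‖ ^ 2) ≤ posTrace u * ENNReal.ofReal (‖x‖ ^ 2) := by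
      rw [ofReal_norm_sq_eq_tsum (stdBasis E), posTrace, ← ENNReal.tsum_mul_right]
      refine ENNReal.tsum_le_tsum fun i => ?_
      rw [inner_eq_norm_sqrt_sq hu, ← ENNReal.ofReal_mul (by positivity), ← mul_pow]
      refine ENNReal.ofReal_le_ofReal (pow_le_pow_left₀ (norm_nonneg _) ?_ 2)
      rw [← ContinuousLinearMap.adjoint_inner_left, hs.adjoint_eq]
      exact norm_inner_le_norm _ _
    rw [← ENNReal.ofReal_toReal h, ← ENNReal.ofReal_mul ENNReal.toReal_nonneg] at h1
    exact (ENNReal.ofReal_le_ofReal_iff (by positivity)).1 h1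
  have h2 : ‖CFC.sqrt u‖ ≤ √(posTrace u).toReal := by
    refine ContinuousLinearMap.opNorm_le_bound _ (Real.sqrt_nonneg _) fun x => ?_
    refine abs_le_of_sq_le_sq' ?_ (by positivity) |>.2
    rw [mul_pow, Real.sq_sqrt ENNReal.toReal_nonneg]
    exact key x
  refine ENNReal.ofReal_le_of_le_toReal ?_
  calc ‖u‖ = ‖CFC.sqrt u * CFC.sqrt u‖ := by rw [CFC.sqrt_mul_sqrt_self u hu]
    _ ≤ ‖CFC.sqrt u‖ * ‖CFC.sqrt u‖ := norm_mul_le _ _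
    _ ≤ √(posTrace u).toReal * √(posTrace u).toReal := by gcongr
    _ = (posTrace u).toReal := Real.mul_self_sqrt ENNReal.toReal_nonneg

/-- The trace is countably additive on positive operators. -/
theorem posTrace_eq_tsum_of_hasSum {f : ℕ → E →L[ℂ] E} {u : E →L[ℂ] E} (hf : ∀ n, 0 ≤ f n)
    (h : HasSum f u) : posTrace u = ∑' n, posTrace (f n) := by
  unfold posTrace
  rw [ENNReal.tsum_comm]
  refine tsum_congr fun i => ?_
  have h1 := Complex.hasSum_re
    (((innerSL ℂ (stdBasis E i)).hasSum ((ContinuousLinearMap.apply ℂ E (stdBasis E i)).hasSum h)))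
  have h2 : (inner ℂ (stdBasis E i) (u (stdBasis E i))).re =
      ∑' n, (inner ℂ (stdBasis E i) (f n (stdBasis E i))).re := h1.tsum_eq.symm
  rw [h2]
  exact ENNReal.ofReal_tsum_of_nonneg (fun n => re_inner_nonneg (hf n) _) h1.summable

end TraceClass

/-! ### Completeness in the trace norm and the cone of positive operators. -/

namespace TraceClassSA

open TraceClass

variable {E : Type*} [NormedAddCommGroup E] [InnerProductSpace ℂ E] [CompleteSpace E]

theorem nonneg_iff {u : TraceClassSA E} : Nonneg u ↔ 0 ≤ toOp u :=
  (ContinuousLinearMap.nonneg_iff_isPositive _).symm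

theorem norm_of_nonneg {u : TraceClassSA E} (hu : Nonneg u) :
    ‖u‖ = (posTrace (toOp u)).toReal := by
  rw [norm_def, CFC.abs_of_nonneg _ (nonneg_iff.1 hu)]

theorem posTrace_lt_top {u : TraceClassSA E} (hu : Nonneg u) : posTrace (toOp u) < ∞ := by
  have h := isTraceClass_toOp u
  rwa [IsTraceClass, CFC.abs_of_nonneg _ (nonneg_iff.1 hu)] at h

theorem norm_eq_trace {u : TraceClassSA E} (hu : Nonneg u) : ‖u‖ = trace u := by
  rw [norm_of_nonneg hu]
  exact (hasSum_re_inner_of_nonneg (nonneg_iff.1 hu) (posTrace_lt_top hu)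
    (stdBasis E)).tsum_eq.symm

/-- A positive operator of finite trace as an element of `TraceClassSA E`. -/
noncomputable def ofNonneg (v : E →L[ℂ] E) (hv : 0 ≤ v) (h : posTrace v < ∞) : TraceClassSA E :=
  ⟨v, IsSelfAdjoint.of_nonneg hv, by rwa [IsTraceClass, CFC.abs_of_nonneg _ hv]⟩

@[simp]
theorem toOp_ofNonneg (v : E →L[ℂ] E) (hv : 0 ≤ v) (h : posTrace v < ∞) :
    toOp (ofNonneg v hv h) = v :=
  rfl

theorem nonneg_ofNonneg (v : E →L[ℂ] E) (hv : 0 ≤ v) (h : posTrace v < ∞) :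
    Nonneg (ofNonneg v hv h) :=
  nonneg_iff.2 hv

/-- The Jordan decomposition does it: `|u| = u⁺ + u⁻`, and traces of positive operators add. -/
theorem exists_sub (u : TraceClassSA E) :
    ∃ p q : TraceClassSA E, Nonneg p ∧ Nonneg q ∧ u = p - q ∧ ‖p‖ + ‖q‖ = ‖u‖ := by
  have hsa := isSelfAdjoint_toOp u
  have hp := CFC.posPart_nonneg (toOp u)
  have hn := CFC.negPart_nonneg (toOp u)
  have hfin := isTraceClass_toOp u
  unfold IsTraceClass at hfin
  have habs : posTrace (CFC.abs (toOp u)) = posTrace (toOp u)⁺ + posTrace (toOp u)⁻ := by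
    rw [← CFC.posPart_add_negPart _ hsa, posTrace_add hp hn]
  rw [habs, ENNReal.add_lt_top] at hfin
  refine ⟨ofNonneg _ hp hfin.1, ofNonneg _ hn hfin.2, nonneg_ofNonneg _ _ _,
    nonneg_ofNonneg _ _ _, toOp_injective ?_, ?_⟩
  · rw [map_sub, toOp_ofNonneg, toOp_ofNonneg, CFC.posPart_sub_negPart _ hsa]
  · rw [norm_of_nonneg (nonneg_ofNonneg _ _ _), norm_of_nonneg (nonneg_ofNonneg _ _ _), norm_def,
      habs, ENNReal.toReal_add hfin.1.ne hfin.2.ne]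
    rfl

theorem norm_toOp_le (u : TraceClassSA E) : ‖toOp u‖ ≤ ‖u‖ := by
  have key : ∀ v : TraceClassSA E, Nonneg v → ‖toOp v‖ ≤ ‖v‖ := fun v hv => by
    rw [norm_of_nonneg hv]
    exact (ENNReal.ofReal_le_iff_le_toReal (posTrace_lt_top hv).ne).1
      (ofReal_norm_le_posTrace (nonneg_iff.1 hv))
  obtain ⟨p, q, hp, hq, rfl, h⟩ := exists_sub u
  rw [← h, map_sub]
  exact (norm_sub_le _ _).trans (add_le_add (key p hp) (key q hq))

theorem continuous_toOp : Continuous (toOp (E := E)) :=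
  AddMonoidHomClass.continuous_of_bound (toOp (E := E)) 1 fun u => by
    simpa using norm_toOp_le u

/-- An absolutely convergent series of positive operators converges in the trace norm. -/
theorem exists_hasSum_of_nonneg {p : ℕ → TraceClassSA E} (hp : ∀ n, Nonneg (p n))
    (hs : Summable fun n => ‖p n‖) :
    ∃ a, Tendsto (fun n => ∑ i ∈ Finset.range n, p i) atTop (𝓝 a) := by
  have hpo : ∀ n, 0 ≤ toOp (p n) := fun n => nonneg_iff.1 (hp n)
  have hsop : Summable fun n => toOp (p n) :=
    Summable.of_norm_bounded hs fun n => norm_toOp_le (p n)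
  have htr : ∀ n, posTrace (toOp (p n)) = ENNReal.ofReal ‖p n‖ := fun n => by
    rw [norm_of_nonneg (hp n), ENNReal.ofReal_toReal (posTrace_lt_top (hp n)).ne]
  -- The error after `N` terms is itself positive, so its trace norm is its trace, and countable
  -- additivity makes that the tail of the convergent series of norms.
  have hsum : ∀ N, posTrace (∑' n, toOp (p (n + N))) = ENNReal.ofReal (∑' n, ‖p (n + N)‖) :=
    fun N => by
      rw [posTrace_eq_tsum_of_hasSum (fun n => hpo (n + N))
        ((summable_nat_add_iff N).2 hsop).hasSum,
        ENNReal.ofReal_tsum_of_nonneg (fun _ => norm_nonneg _) ((summable_nat_add_iff N).2 hs)]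
      exact tsum_congr fun n => htr _
  have hnn : ∀ N, 0 ≤ ∑' n, toOp (p (n + N)) := fun N => tsum_nonneg fun n => hpo _
  -- The limit is written as the tail from `0`, so that `hnn` and `hsum` apply verbatim.
  refine ⟨ofNonneg (∑' n, toOp (p (n + 0))) (hnn 0) (hsum 0 ▸ ENNReal.ofReal_lt_top), ?_⟩
  rw [tendsto_iff_norm_sub_tendsto_zero]
  have h0 := tendsto_sum_nat_add fun n => ‖p n‖
  refine h0.congr fun N => ?_
  have h1 : toOp (ofNonneg (∑' n, toOp (p (n + 0))) (hnn 0) (hsum 0 ▸ ENNReal.ofReal_lt_top) -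
      ∑ i ∈ Finset.range N, p i) = ∑' n, toOp (p (n + N)) := by
    rw [map_sub, map_sum, toOp_ofNonneg, sub_eq_iff_eq_add', hsop.sum_add_tsum_nat_add N]
    rfl
  rw [norm_sub_rev, norm_of_nonneg (nonneg_iff.2 (by rw [h1]; exact hnn N)), h1, hsum,
    ENNReal.toReal_ofReal (tsum_nonneg fun _ => norm_nonneg _)]

/-- Absolutely convergent series suffice. The Jordan parts of the terms have no larger norms, so
they form two convergent series of positive operators. -/
instance : CompleteSpace (TraceClassSA E) := by
  refine NormedAddCommGroup.completeSpace_of_summable_imp_tendsto fun u hu => ?_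
  choose p q hp hq hpq hn using fun n => exists_sub (u n)
  obtain ⟨a, ha⟩ := exists_hasSum_of_nonneg hp (Summable.of_nonneg_of_le (fun _ => norm_nonneg _)
    (fun n => by have := norm_nonneg (q n); have := hn n; linarith) hu)
  obtain ⟨b, hb⟩ := exists_hasSum_of_nonneg hq (Summable.of_nonneg_of_le (fun _ => norm_nonneg _)
    (fun n => by have := norm_nonneg (p n); have := hn n; linarith) hu)
  refine ⟨a - b, (ha.sub hb).congr fun n => ?_⟩
  rw [← Finset.sum_sub_distrib]
  exact Finset.sum_congr rfl fun i _ => (hpq i).symm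

/-- The cone of positive trace-class operators. -/
noncomputable def nonnegCone (E : Type*) [NormedAddCommGroup E] [InnerProductSpace ℂ E] [CompleteSpace E] :
    PointedCone ℝ (TraceClassSA E) where
  carrier := {u | Nonneg u}
  add_mem' {u v} hu hv := by
    simp only [Set.mem_ofPred_eq, nonneg_iff, map_add] at *
    exact add_nonneg hu hv
  zero_mem' := by simp [nonneg_iff]
  smul_mem' c u hu := by
    simp only [Set.mem_ofPred_eq, nonneg_iff] at *
    change 0 ≤ toOp ((c : ℝ) • u)
    rw [map_smul]
    exact smul_nonneg c.2 hu

/-- The trace as a linear functional. -/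
noncomputable def traceₗ (E : Type*) [NormedAddCommGroup E] [InnerProductSpace ℂ E] [CompleteSpace E] :
    TraceClassSA E →ₗ[ℝ] ℝ where
  toFun := trace
  map_add' u v := by
    refine (hasSum_trace (u + v) (stdBasis E)).unique ?_
    simpa [inner_add_right] using (hasSum_trace u (stdBasis E)).add (hasSum_trace v (stdBasis E))
  map_smul' c u := by
    refine (hasSum_trace (c • u) (stdBasis E)).unique ?_
    have h : ∀ x : E, (inner ℂ x (toOp (c • u) x)).re = c * (inner ℂ x (toOp u x)).re :=
      fun x => by
        rw [map_smul, smul_apply, inner_smul_right_eq_smul, Complex.smul_re, smul_eq_mul]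
    simp only [h]
    exact (hasSum_trace u (stdBasis E)).mul_left c

@[simp]
theorem traceₗ_apply (u : TraceClassSA E) : traceₗ E u = trace u :=
  rfl

/-- The cone is closed because the trace norm dominates the operator norm, in which positivity is a
closed condition. -/
theorem isBaseNormCone : IsBaseNormCone (nonnegCone E) (traceₗ E) where
  isClosed := by
    have h : (nonnegCone E : Set (TraceClassSA E)) = toOp ⁻¹' {v | 0 ≤ v} := by
      ext u
      exact nonneg_iff
    rw [h]
    exact isClosed_Ici.preimage continuous_toOp
  norm_eq _ hu := norm_eq_trace hu
  exists_sub u := by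
    obtain ⟨p, q, hp, hq, h⟩ := exists_sub u
    exact ⟨p, hp, q, hq, h⟩

end TraceClassSA

/-! ### Shifted operators, their resolvents, and a positive Neumann series. -/

section

variable {X : Type*} [NormedAddCommGroup X] [NormedSpace ℝ X]

namespace LinearPMap

@[simp]
theorem shift_apply (A : X →ₗ.[ℝ] X) (lam : ℝ) (x : A.domain) :
    A.shift lam x = lam • (x : X) + A x :=
  rfl

@[simp]
theorem shift_resolvent (A : X →ₗ.[ℝ] X) (lam : ℝ) (h : Function.Bijective (A.shift lam)) (u : X) :
    A.shift lam (A.resolvent lam h u) = u :=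
  (LinearEquiv.ofBijective (A.shift lam) h).apply_symm_apply u

@[simp]
theorem resolvent_shift (A : X →ₗ.[ℝ] X) (lam : ℝ) (h : Function.Bijective (A.shift lam))
    (x : A.domain) : A.resolvent lam h (A.shift lam x) = x :=
  (LinearEquiv.ofBijective (A.shift lam) h).symm_apply_apply x

theorem bijective_shift_of_le {A : X →ₗ.[ℝ] X} {lam c : ℝ} (hc : 0 < c)
    (hs : Function.Surjective (A.shift lam))
    (hA : ∀ x : A.domain, c * ‖(x : X)‖ ≤ ‖A.shift lam x‖) : Function.Bijective (A.shift lam) := by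
  refine ⟨(injective_iff_map_eq_zero _).2 fun x hx => ?_, hs⟩
  have h := hA x
  rw [hx, norm_zero] at h
  have h1 : ‖(x : X)‖ ≤ 0 := by
    by_contra! h2
    exact absurd (mul_pos hc h2) (not_lt.2 h)
  exact Subtype.ext (norm_le_zero_iff.1 h1)

theorem norm_resolvent_le {A : X →ₗ.[ℝ] X} {lam c : ℝ} (hc : 0 < c)
    (h : Function.Bijective (A.shift lam))
    (hA : ∀ x : A.domain, c * ‖(x : X)‖ ≤ ‖A.shift lam x‖) (u : X) :
    ‖(A.resolvent lam h u : X)‖ ≤ c⁻¹ * ‖u‖ := by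
  have h1 := hA (A.resolvent lam h u)
  rw [shift_resolvent] at h1
  rwa [inv_mul_eq_div, le_div_iff₀' hc]

theorem mem_neg_graph {A : X →ₗ.[ℝ] X} {u v : X} :
    (u, v) ∈ (-A).graph ↔ ∃ x : A.domain, (x : X) = u ∧ A x = -v := by
  rw [LinearPMap.mem_graph_iff]
  constructor
  · rintro ⟨y, hy, hv⟩
    exact ⟨y, hy, by rw [← show -(A y) = v from hv, neg_neg]⟩
  · rintro ⟨y, hy, hv⟩
    exact ⟨y, hy, by change -(A y) = v; rw [hv, neg_neg]⟩

end LinearPMap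

/-- The Neumann series, together with its positivity. -/
theorem exists_sub_apply_eq [CompleteSpace X] {C : PointedCone ℝ X} (hC : IsClosed (C : Set X))
    {Q : X →L[ℝ] X} (hQ : ‖Q‖ < 1) (hQC : ∀ u ∈ C, Q u ∈ C) (u : X) :
    ∃ y, y - Q y = u ∧ (u ∈ C → y ∈ C) := by
  have hs : Summable fun n : ℕ => Q ^ n := summable_geometric_of_norm_lt_one hQ
  refine ⟨(∑' n : ℕ, Q ^ n) u, ?_, fun hu => ?_⟩
  · exact DFunLike.congr_fun (mul_neg_geom_series Q hQ) u
  · have h1 : HasSum (fun n : ℕ => (Q ^ n) u) ((∑' n : ℕ, Q ^ n) u) :=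
      (ContinuousLinearMap.apply ℝ X u).hasSum hs.hasSum
    have h2 : ∀ n : ℕ, (Q ^ n) u ∈ C := by
      intro n
      induction n with
      | zero => simpa using hu
      | succ n ih => rw [pow_succ']; exact hQC _ ih
    exact hC.mem_of_tendsto h1 (Eventually.of_forall fun s => C.sum_mem fun i _ => h2 i)

/-! ### Contraction semigroups: continuity, dissipativity and truncated Laplace integrals. -/

namespace IsC0Semigroup

variable {S : ℝ≥0 → X →L[ℝ] X}

theorem norm_apply_le (hc : IsContractive S) (t : ℝ≥0) (u : X) : ‖S t u‖ ≤ ‖u‖ :=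
  ((S t).le_opNorm u).trans (mul_le_of_le_one_left (norm_nonneg u) (hc t))

theorem apply_zero (hS : IsC0Semigroup S) (u : X) : S 0 u = u := by
  rw [hS.zero]; rfl

theorem apply_add (hS : IsC0Semigroup S) (s t : ℝ≥0) (u : X) : S (s + t) u = S s (S t u) := by
  rw [hS.add]; rfl

theorem norm_sub_le (hS : IsC0Semigroup S) (hc : IsContractive S) (s t : ℝ≥0) (u : X) :
    ‖S s u - S t u‖ ≤ ‖S (nndist s t) u - u‖ := by
  wlog h : t ≤ s generalizing s t
  · rw [norm_sub_rev, nndist_comm]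
    exact this t s (le_of_not_ge h)
  have h1 : nndist s t = s - t := by
    rw [NNReal.nndist_eq, tsub_eq_zero_of_le h, max_eq_left zero_le]
  rw [h1]
  calc ‖S s u - S t u‖ = ‖S t (S (s - t) u - u)‖ := by
        rw [map_sub, ← hS.apply_add, add_tsub_cancel_of_le h]
    _ ≤ _ := norm_apply_le hc _ _

theorem continuous_apply (hS : IsC0Semigroup S) (hc : IsContractive S) (u : X) :
    Continuous fun t => S t u := by
  have h0 : Tendsto (fun t => S t u) (𝓝 0) (𝓝 u) := by
    have h1 : ContinuousWithinAt (fun t => S t u) (Set.Ioi 0) 0 := by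
      simpa only [ContinuousWithinAt, hS.apply_zero] using hS.tendsto u
    rw [continuousWithinAt_Ioi_iff_Ici] at h1
    have h2 : Set.Ici (0 : ℝ≥0) = Set.univ := by ext; simp
    rw [h2, continuousWithinAt_univ, ContinuousAt, hS.apply_zero] at h1
    exact h1
  refine continuous_iff_continuousAt.2 fun t => ?_
  rw [ContinuousAt, tendsto_iff_norm_sub_tendsto_zero]
  have h3 : Tendsto (fun s => nndist s t) (𝓝 t) (𝓝 0) := by
    have : Continuous fun s => nndist s t := by fun_prop
    simpa using this.tendsto t
  have h4 : Tendsto (fun s => ‖S (nndist s t) u - u‖) (𝓝 t) (𝓝 0) :=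
    (tendsto_iff_norm_sub_tendsto_zero.1 h0).comp h3
  exact squeeze_zero (fun _ => norm_nonneg _) (fun s => hS.norm_sub_le hc s t u) h4

/-- The generator of a contraction semigroup is dissipative. -/
theorem mul_norm_le_of_tendsto (hc : IsContractive S) {u v : X} {lam : ℝ} (hl : 0 < lam)
    (h : Tendsto (fun t : ℝ≥0 => (t : ℝ)⁻¹ • (S t u - u)) (𝓝[>] 0) (𝓝 v)) :
    lam * ‖u‖ ≤ ‖lam • u - v‖ := by
  refine ge_of_tendsto (tendsto_const_nhds (x := lam • u) |>.sub h).norm ?_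
  filter_upwards [self_mem_nhdsWithin] with t ht
  have ht' : (0 : ℝ) < t := ht
  -- The difference quotient contributes `t⁻¹` to both terms; as `‖S t u‖ ≤ ‖u‖`, these
  -- contributions cancel in the reverse triangle inequality.
  have e : lam • u - (t : ℝ)⁻¹ • (S t u - u) = (lam + (t : ℝ)⁻¹) • u - (t : ℝ)⁻¹ • S t u := by
    module
  rw [e]
  refine le_trans ?_ (norm_sub_norm_le _ _)
  rw [norm_smul, norm_smul, Real.norm_of_nonneg (by positivity), Real.norm_of_nonneg (by positivity)]
  have := mul_le_mul_of_nonneg_left (norm_apply_le hc t u) (inv_nonneg.2 ht'.le)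
  linarith

theorem continuous_integrand (hS : IsC0Semigroup S) (hc : IsContractive S) (lam : ℝ) (u : X) :
    Continuous fun s : ℝ => Real.exp (-lam * s) • S s.toNNReal u :=
  (by fun_prop : Continuous fun s : ℝ => Real.exp (-lam * s)).smul
    ((hS.continuous_apply hc u).comp continuous_real_toNNReal)

theorem tendsto_inv_smul {f : ℝ → X} {v : X} (h : HasDerivAt f v 0) :
    Tendsto (fun t : ℝ≥0 => (t : ℝ)⁻¹ • (f t - f 0)) (𝓝[>] 0) (𝓝 v) := by
  have h1 := hasDerivAt_iff_tendsto_slope_zero.1 h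
  simp only [zero_add] at h1
  refine h1.comp (tendsto_nhdsWithin_iff.2 ⟨?_, ?_⟩)
  · exact (NNReal.continuous_coe.tendsto 0).mono_left nhdsWithin_le_nhds
  · filter_upwards [self_mem_nhdsWithin] with t ht
    exact fun h => (ne_of_gt ht) (NNReal.coe_eq_zero.1 h)

variable [CompleteSpace X]

/-- Substitute `s ↦ s + t` and use the semigroup law. The action of `S t` becomes an expression in
the primitive of the integrand, which can be differentiated in `t`. -/
theorem apply_integral (hS : IsC0Semigroup S) (hc : IsContractive S) (lam : ℝ) (h t : ℝ≥0)
    (u : X) : S t (∫ s in (0 : ℝ)..h, Real.exp (-lam * s) • S s.toNNReal u) =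
      Real.exp (lam * t) • ((∫ s in (0 : ℝ)..(h + t), Real.exp (-lam * s) • S s.toNNReal u) -
        ∫ s in (0 : ℝ)..t, Real.exp (-lam * s) • S s.toNNReal u) := by
  have hg := hS.continuous_integrand hc lam u
  rw [← ContinuousLinearMap.intervalIntegral_comp_comm _ (hg.intervalIntegrable _ _),
    intervalIntegral.integral_interval_sub_left (hg.intervalIntegrable _ _)
      (hg.intervalIntegrable _ _)]
  have h1 := intervalIntegral.integral_comp_add_right (a := (0 : ℝ)) (b := h)
    (fun s : ℝ => Real.exp (-lam * s) • S s.toNNReal u) t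
  rw [zero_add] at h1
  rw [← h1, ← intervalIntegral.integral_smul]
  refine intervalIntegral.integral_congr fun s hs => ?_
  rw [Set.uIcc_of_le (NNReal.coe_nonneg h)] at hs
  have h2 : (s + t).toNNReal = t + s.toNNReal := by
    rw [Real.toNNReal_add hs.1 t.coe_nonneg, Real.toNNReal_coe, add_comm]
  simp only [map_smul, h2, hS.apply_add, smul_smul, ← Real.exp_add]
  congr 2
  ring

theorem hasDerivAt_integral (hS : IsC0Semigroup S) (hc : IsContractive S) (lam : ℝ) (u : X)
    (x : ℝ) : HasDerivAt (fun y => ∫ s in (0 : ℝ)..y, Real.exp (-lam * s) • S s.toNNReal u)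
      (Real.exp (-lam * x) • S x.toNNReal u) x :=
  (hS.continuous_integrand hc lam u).integral_hasStrictDerivAt 0 x |>.hasDerivAt

/-- Differentiating `apply_integral` at `t = 0` puts `w` in the domain of the generator `A`, with
`(λ - A) w = u - exp (-λ h) S_h u`. A finite `h` avoids improper integrals; `λ = 0` serves density
of the domain and `h = 1` the resolvent. -/
theorem tendsto_integral (hS : IsC0Semigroup S) (hc : IsContractive S) (lam : ℝ) (h : ℝ≥0)
    (u : X) {w : X} (hw : w = ∫ s in (0 : ℝ)..h, Real.exp (-lam * s) • S s.toNNReal u) :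
    Tendsto (fun t : ℝ≥0 => (t : ℝ)⁻¹ • (S t w - w)) (𝓝[>] 0)
      (𝓝 (lam • w - (u - Real.exp (-lam * h) • S h u))) := by
  set F := fun y => ∫ s in (0 : ℝ)..y, Real.exp (-lam * s) • S s.toNNReal u with hF
  have h0 : F 0 = 0 := by simp [hF]
  have hFd : ∀ x, HasDerivAt F (Real.exp (-lam * x) • S x.toNNReal u) x :=
    hS.hasDerivAt_integral hc lam u
  have h1 : HasDerivAt (fun t : ℝ => Real.exp (lam * t) • (F (h + t) - F t))
      (lam • w - (u - Real.exp (-lam * h) • S h u)) 0 := by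
    have e1 : HasDerivAt (fun t : ℝ => Real.exp (lam * t)) lam 0 := by
      simpa using ((hasDerivAt_id (0 : ℝ)).const_mul lam).exp
    have e2 : HasDerivAt (fun t : ℝ => F (h + t)) (Real.exp (-lam * h) • S h u) 0 := by
      simpa using (hFd (h + 0)).comp_const_add (h : ℝ) 0
    have e3 : HasDerivAt F u 0 := by
      simpa [hS.apply_zero] using hFd 0
    convert e1.smul (e2.sub e3) using 1
    · rfl
    · simp only [Pi.sub_apply, add_zero, h0, sub_zero, mul_zero, Real.exp_zero, one_smul,
        show w = F h from hw]
      abel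
  have h2 := tendsto_inv_smul h1
  refine h2.congr fun t => ?_
  simp only [add_zero, h0, sub_zero, mul_zero, Real.exp_zero, one_smul]
  rw [hw, hS.apply_integral hc]

end IsC0Semigroup

/-! ### Generators of contraction semigroups: dense domain and positive resolvents. -/

namespace IsGenerator

variable {S : ℝ≥0 → X →L[ℝ] X} {H : X →ₗ.[ℝ] X}

theorem tendsto (hG : IsGenerator S (-H)) (x : H.domain) :
    Tendsto (fun t : ℝ≥0 => (t : ℝ)⁻¹ • (S t (x : X) - x)) (𝓝[>] 0) (𝓝 (-(H x))) :=
  (hG _ _).1 (LinearPMap.mem_neg_graph.2 ⟨x, rfl, (neg_neg _).symm⟩)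

theorem mul_norm_le (hG : IsGenerator S (-H)) (hc : IsContractive S) {lam : ℝ} (hl : 0 < lam)
    (x : H.domain) : lam * ‖(x : X)‖ ≤ ‖H.shift lam x‖ := by
  have h := IsC0Semigroup.mul_norm_le_of_tendsto hc hl (hG.tendsto x)
  rwa [sub_neg_eq_add] at h

variable [CompleteSpace X]

/-- The averages `h⁻¹ ∫₀ʰ S_s u ds` lie in the domain and tend to `u`. -/
theorem dense_domain (hG : IsGenerator S (-H)) (hS : IsC0Semigroup S) (hc : IsContractive S) :
    Dense (H.domain : Set X) := by
  intro u
  have h1 : HasDerivAt (fun y => ∫ s in (0 : ℝ)..y, Real.exp (-0 * s) • S s.toNNReal u) u 0 := by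
    simpa [hS.apply_zero] using hS.hasDerivAt_integral hc 0 u 0
  refine mem_closure_of_tendsto (IsC0Semigroup.tendsto_inv_smul h1) (Eventually.of_forall fun h => ?_)
  obtain ⟨x, hx, -⟩ := LinearPMap.mem_neg_graph.1 ((hG _ _).2 (hS.tendsto_integral hc 0 h u rfl))
  rw [intervalIntegral.integral_same, sub_zero, ← hx]
  exact H.domain.smul_mem _ x.2

/-- Solve `y - exp (-λ) S₁ y = u` by a Neumann series; then `x = ∫₀¹ exp (-λ s) S_s y ds` satisfies
`(λ + H) x = u`. Both steps keep the closed cone invariant. -/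
theorem exists_shift_eq (hG : IsGenerator S (-H)) (hS : IsC0Semigroup S) (hc : IsContractive S)
    {C : PointedCone ℝ X} (hC : IsClosed (C : Set X)) (hSC : ∀ t, ∀ u ∈ C, S t u ∈ C)
    {lam : ℝ} (hl : 0 < lam) (u : X) :
    ∃ x : H.domain, H.shift lam x = u ∧ (u ∈ C → (x : X) ∈ C) := by
  have hsmul : ∀ c : ℝ, 0 ≤ c → ∀ x ∈ C, c • x ∈ C := fun c hc x hx => C.smul_mem hc hx
  have hQ : ‖Real.exp (-lam * (1 : ℝ≥0)) • S 1‖ < 1 := by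
    rw [norm_smul, Real.norm_of_nonneg (Real.exp_pos _).le]
    have h1 : Real.exp (-lam * (1 : ℝ≥0)) < 1 := by
      rw [Real.exp_lt_one_iff]; simpa using hl
    exact (mul_le_of_le_one_right (Real.exp_pos _).le (hc 1)).trans_lt h1
  obtain ⟨y, hy, hyC⟩ := exists_sub_apply_eq hC hQ
    (fun u hu => hsmul _ (Real.exp_pos _).le _ (hSC 1 u hu)) u
  obtain ⟨x, hx, hHx⟩ := LinearPMap.mem_neg_graph.1
    ((hG _ _).2 (hS.tendsto_integral hc lam 1 y rfl))
  refine ⟨x, ?_, fun hu => ?_⟩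
  · rw [LinearPMap.shift_apply, hHx, ← hx, neg_sub, add_sub_cancel]
    exact hy
  · rw [hx, NNReal.coe_one, intervalIntegral.integral_of_le zero_le_one]
    have hconv : Convex ℝ (C : Set X) := fun x hx y hy a b ha hb _ =>
      C.add_mem (hsmul a ha x hx) (hsmul b hb y hy)
    -- Over an interval of length one the integral is an average, hence stays in a closed convex
    -- set.
    have : MeasureTheory.IsProbabilityMeasure
        (MeasureTheory.volume.restrict (Set.Ioc (0 : ℝ) 1)) := ⟨by simp⟩
    refine hconv.integral_mem hC (Eventually.of_forall fun s => ?_) ?_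
    · exact hsmul _ (Real.exp_pos _).le _ (hSC _ _ (hyC hu))
    · exact ((hS.continuous_integrand hc lam y).intervalIntegrable 0 1).1

/-- The resolvent set of the negative `H` of the generator of a contraction semigroup. -/
theorem bijective_shift (hG : IsGenerator S (-H)) (hS : IsC0Semigroup S) (hc : IsContractive S)
    {lam : ℝ} (hl : 0 < lam) : Function.Bijective (H.shift lam) :=
  LinearPMap.bijective_shift_of_le hl (fun u => by
    -- With the whole space as cone the positivity requirement is void.
    obtain ⟨x, hx, -⟩ := hG.exists_shift_eq hS hc (C := ⊤) isClosed_univ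
      (fun _ _ _ => trivial) hl u
    exact ⟨x, hx⟩) fun x => hG.mul_norm_le hc hl x

theorem resolvent_mem (hG : IsGenerator S (-H)) (hS : IsC0Semigroup S) (hc : IsContractive S)
    {C : PointedCone ℝ X} (hC : IsClosed (C : Set X)) (hSC : ∀ t, ∀ u ∈ C, S t u ∈ C)
    {lam : ℝ} (hl : 0 < lam) (h : Function.Bijective (H.shift lam)) {u : X} (hu : u ∈ C) :
    (H.resolvent lam h u : X) ∈ C := by
  obtain ⟨x, hx, hxC⟩ := hG.exists_shift_eq hS hc hC hSC hl u
  rw [← hx, LinearPMap.resolvent_shift]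
  exact hxC hu

end IsGenerator

end

section

variable {X : Type*} [NormedAddCommGroup X] [NormedSpace ℝ X]

/-! ### Limits of sequences of contractions -/

theorem cauchySeq_apply_of_dense {J : ℕ → X →L[ℝ] X} (hJ : ∀ n, ‖J n‖ ≤ 1) {D : Set X}
    (hD : Dense D) (h : ∀ x ∈ D, CauchySeq fun n => J n x) (x : X) :
    CauchySeq fun n => J n x := by
  rw [Metric.cauchySeq_iff']
  intro ε hε
  obtain ⟨y, hyD, hy⟩ := hD.exists_dist_lt x (show 0 < ε / 3 by positivity)
  obtain ⟨N, hN⟩ := Metric.cauchySeq_iff'.1 (h y hyD) (ε / 3) (by positivity)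
  have hd : ∀ n, dist (J n x) (J n y) < ε / 3 := fun n => by
    rw [dist_eq_norm, ← map_sub]
    rw [dist_eq_norm] at hy
    exact ((J n).le_of_opNorm_le (hJ n) _).trans_lt (by rwa [one_mul])
  refine ⟨N, fun n hn => ?_⟩
  have h1 := hN n hn
  have h2 := dist_triangle4 (J n x) (J n y) (J N y) (J N x)
  have h3 := hd n
  have h4 := hd N
  rw [dist_comm] at h4
  linarith

theorem tendsto_apply_of_dense {ι : Type*} {l : Filter ι} {J : ι → X →L[ℝ] X}
    (hJ : ∀ n, ‖J n‖ ≤ 1) {D : Set X} (hD : Dense D)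
    (h : ∀ x ∈ D, Tendsto (fun n => J n x) l (𝓝 x)) (x : X) :
    Tendsto (fun n => J n x) l (𝓝 x) := by
  rw [Metric.tendsto_nhds]
  intro ε hε
  obtain ⟨y, hyD, hy⟩ := hD.exists_dist_lt x (show 0 < ε / 3 by positivity)
  filter_upwards [Metric.tendsto_nhds.1 (h y hyD) (ε / 3) (by positivity)] with n hn
  have hd : dist (J n x) (J n y) < ε / 3 := by
    rw [dist_eq_norm, ← map_sub]
    rw [dist_eq_norm] at hy
    exact ((J n).le_of_opNorm_le (hJ n) _).trans_lt (by rwa [one_mul])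
  have h2 := dist_triangle4 (J n x) (J n y) y x
  rw [dist_comm] at hy
  linarith

theorem tendsto_apply_apply {ι : Type*} {l : Filter ι} {J : ι → X →L[ℝ] X}
    (hJ : ∀ n, ‖J n‖ ≤ 1) {y : ι → X} {x z : X} (hy : Tendsto y l (𝓝 x))
    (h : Tendsto (fun n => J n x) l (𝓝 z)) : Tendsto (fun n => J n (y n)) l (𝓝 z) := by
  have h1 : Tendsto (fun n => J n (y n - x)) l (𝓝 0) :=
    squeeze_zero_norm (fun n => by simpa using (J n).le_of_opNorm_le (hJ n) (y n - x))
      (tendsto_iff_norm_sub_tendsto_zero.1 hy)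
  simpa using h1.add h

/-! ### Exponentials of bounded operators -/

variable [CompleteSpace X]

theorem hasDerivAt_exp_smul_apply (A : X →L[ℝ] X) (x : X) (t : ℝ) :
    HasDerivAt (fun s : ℝ => NormedSpace.exp (s • A) x) (NormedSpace.exp (t • A) (A x)) t :=
  ((ContinuousLinearMap.apply ℝ X x).hasFDerivAt.comp_hasDerivAt t
    (hasDerivAt_exp_smul_const (𝕂 := ℝ) A t))

theorem exp_add_apply {A C : X →L[ℝ] X} (h : Commute A C) (x : X) :
    NormedSpace.exp (A + C) x = NormedSpace.exp A (NormedSpace.exp C x) := by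
  let _ : NormedAlgebra ℚ (X →L[ℝ] X) := NormedAlgebra.restrictScalars ℚ ℝ _
  rw [NormedSpace.exp_add_of_commute h]
  rfl

/-- Exponentials of commuting generators of contractions differ by at most the difference of the
generators. -/
theorem norm_exp_sub_exp_le {A C : X →L[ℝ] X} (h : Commute A C)
    (hA : ∀ t : ℝ, 0 ≤ t → ‖NormedSpace.exp (t • A)‖ ≤ 1)
    (hC : ∀ t : ℝ, 0 ≤ t → ‖NormedSpace.exp (t • C)‖ ≤ 1) {t : ℝ} (ht : 0 ≤ t) (x : X) :
    ‖NormedSpace.exp (t • A) x - NormedSpace.exp (t • C) x‖ ≤ ‖A x - C x‖ * t := by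
  have hcomm : ∀ s r : ℝ, Commute (s • A) (r • C) := fun s r => (h.smul_left s).smul_right r
  -- The path `exp (t C) exp (s (A - C)) x` joins the two exponentials. Its derivative equals `exp
  -- (s A) exp ((t - s) C) (A x - C x)`, in which both exponentials are contractions for `0 ≤ s ≤
  -- t`.
  have key : ∀ s : ℝ, ∀ y, NormedSpace.exp (t • C) (NormedSpace.exp (s • (A - C)) y) =
      NormedSpace.exp (s • A) (NormedSpace.exp ((t - s) • C) y) := fun s y => by
    rw [← exp_add_apply (hcomm _ _), ← exp_add_apply]
    · congr 2
      module
    · exact ((h.symm.sub_right (Commute.refl C)).smul_left t).smul_right s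
  have hd : ∀ s : ℝ, HasDerivAt
      (fun s : ℝ => NormedSpace.exp (t • C) (NormedSpace.exp (s • (A - C)) x))
      (NormedSpace.exp (t • C) (NormedSpace.exp (s • (A - C)) ((A - C) x))) s := fun s =>
    (NormedSpace.exp (t • C)).hasFDerivAt.comp_hasDerivAt s (hasDerivAt_exp_smul_apply _ _ _)
  have h1 := norm_image_sub_le_of_norm_deriv_le_segment' (a := 0) (b := t) (C := ‖A x - C x‖)
    (fun s _ => (hd s).hasDerivWithinAt) (fun s hs => by
      rw [key]
      refine ((NormedSpace.exp (s • A)).le_of_opNorm_le (hA s hs.1) _).trans ?_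
      rw [one_mul]
      refine ((NormedSpace.exp ((t - s) • C)).le_of_opNorm_le (hC _ (by linarith [hs.2])) _).trans ?_
      rw [one_mul]
      rfl) t ⟨ht, le_rfl⟩
  simp only [key, sub_self, zero_smul, NormedSpace.exp_zero, sub_zero] at h1
  exact h1

theorem hasSum_exp_smul_apply (J : X →L[ℝ] X) (c : ℝ) (x : X) :
    HasSum (fun n : ℕ => ((n.factorial : ℝ)⁻¹ * c ^ n) • (J ^ n) x)
      (NormedSpace.exp (c • J) x) := by
  have h := (ContinuousLinearMap.apply ℝ X x).hasSum
    (NormedSpace.exp_series_hasSum_exp' (𝕂 := ℝ) (c • J))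
  convert h using 1
  · ext n
    simp [smul_pow, smul_smul]
  · rfl

/-- Splitting off `exp (-c)` leaves a power series in `J` with nonnegative coefficients when `c ≥
0`; contractivity and invariance of the cone then pass from `J` to the exponential. -/
theorem exp_smul_sub_one_apply (J : X →L[ℝ] X) (c : ℝ) (x : X) :
    NormedSpace.exp (c • (J - 1)) x = Real.exp (-c) • NormedSpace.exp (c • J) x := by
  have h1 : c • (J - 1) = (algebraMap ℝ (X →L[ℝ] X) (-c)) + c • J := by
    rw [Algebra.algebraMap_eq_smul_one]
    module
  rw [h1, exp_add_apply (Algebra.commute_algebraMap_left _ _), ← NormedSpace.algebraMap_exp_comm,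
    ← Real.exp_eq_exp_ℝ]
  rfl

theorem norm_exp_smul_sub_one_le {J : X →L[ℝ] X} (hJ : ‖J‖ ≤ 1) {c : ℝ} (hc : 0 ≤ c) :
    ‖NormedSpace.exp (c • (J - 1))‖ ≤ 1 := by
  refine ContinuousLinearMap.opNorm_le_bound _ zero_le_one fun x => ?_
  have hpow : ∀ n : ℕ, ‖(J ^ n) x‖ ≤ ‖x‖ := by
    intro n
    induction n with
    | zero => simp
    | succ n ih =>
      rw [pow_succ']
      exact (J.le_of_opNorm_le hJ _).trans (by rwa [one_mul])
  have hs : HasSum (fun n : ℕ => ((n.factorial : ℝ)⁻¹ * c ^ n) * ‖x‖) (Real.exp c * ‖x‖) := by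
    have := NormedSpace.expSeries_div_hasSum_exp c
    rw [← Real.exp_eq_exp_ℝ] at this
    simpa only [div_eq_inv_mul] using this.mul_right ‖x‖
  have h1 : ‖NormedSpace.exp (c • J) x‖ ≤ Real.exp c * ‖x‖ := by
    rw [← (hasSum_exp_smul_apply J c x).tsum_eq]
    refine tsum_of_norm_bounded hs fun n => ?_
    rw [norm_smul, Real.norm_of_nonneg (by positivity)]
    exact mul_le_mul_of_nonneg_left (hpow n) (by positivity)
  rw [exp_smul_sub_one_apply, norm_smul, Real.norm_of_nonneg (Real.exp_pos _).le, Real.exp_neg,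
    inv_mul_le_iff₀ (Real.exp_pos _), one_mul]
  exact h1

theorem exp_smul_sub_one_mem {C : PointedCone ℝ X} (hC : IsClosed (C : Set X)) {J : X →L[ℝ] X}
    (hJ : ∀ u ∈ C, J u ∈ C) {c : ℝ} (hc : 0 ≤ c) {u : X} (hu : u ∈ C) :
    NormedSpace.exp (c • (J - 1)) u ∈ C := by
  have hpow : ∀ n : ℕ, (J ^ n) u ∈ C := by
    intro n
    induction n with
    | zero => simpa using hu
    | succ n ih => rw [pow_succ']; exact hJ _ ih
  rw [exp_smul_sub_one_apply]
  refine C.smul_mem (Real.exp_pos _).le (hC.mem_of_tendsto (hasSum_exp_smul_apply J c u)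
    (Eventually.of_forall fun s => C.sum_mem fun n _ => C.smul_mem (by positivity) (hpow n)))

end

/-! ### The Hille–Yosida theorem for contraction semigroups -/

namespace LinearPMap.IsMAccretive

variable {X : Type*} [NormedAddCommGroup X] [NormedSpace ℝ X] {B : X →ₗ.[ℝ] X}

/-- The bounded operator `λ (λ I + B)⁻¹`. -/
noncomputable def yosida (hB : B.IsMAccretive) (lam : ℝ) (hl : 0 < lam) : X →L[ℝ] X :=
  lam • LinearMap.mkContinuous (B.domain.subtype ∘ₗ B.resolvent lam (hB.2 lam hl).choose) lam⁻¹
    (hB.2 lam hl).choose_spec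

theorem yosida_apply (hB : B.IsMAccretive) {lam : ℝ} (hl : 0 < lam) (u : X) :
    hB.yosida lam hl u = lam • (B.resolvent lam (hB.2 lam hl).choose u : X) :=
  rfl

theorem norm_yosida_le (hB : B.IsMAccretive) {lam : ℝ} (hl : 0 < lam) :
    ‖hB.yosida lam hl‖ ≤ 1 := by
  rw [yosida, norm_smul, Real.norm_of_nonneg hl.le, ← mul_inv_cancel₀ hl.ne']
  exact mul_le_mul_of_nonneg_left (LinearMap.mkContinuous_norm_le _ (inv_nonneg.2 hl.le) _) hl.le

theorem yosida_shift (hB : B.IsMAccretive) {lam : ℝ} (hl : 0 < lam) (x : B.domain) :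
    hB.yosida lam hl (B.shift lam x) = lam • (x : X) := by
  rw [yosida_apply, resolvent_shift]

theorem exists_eq_shift (hB : B.IsMAccretive) {lam : ℝ} (hl : 0 < lam) (u : X) :
    ∃ x : B.domain, B.shift lam x = u :=
  (hB.2 lam hl).choose.2 u

/-- The left side is the Yosida approximation of `-B` at `x`; the right side shows that it tends to
`-(B x)` once `λ (λ + B)⁻¹` tends strongly to the identity. -/
theorem smul_yosida_sub (hB : B.IsMAccretive) {lam : ℝ} (hl : 0 < lam) (x : B.domain) :
    lam • (hB.yosida lam hl x - x) = -(hB.yosida lam hl (B x)) := by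
  have h := hB.yosida_shift hl x
  rw [shift_apply, _root_.map_add, _root_.map_smul] at h
  rw [smul_sub, ← h]
  abel

/-- The resolvent identity. -/
theorem smul_yosida_sub_smul_yosida (hB : B.IsMAccretive) {lam mu : ℝ} (hl : 0 < lam)
    (hm : 0 < mu) (u : X) : mu • hB.yosida lam hl u - lam • hB.yosida mu hm u =
      (mu - lam) • hB.yosida lam hl (hB.yosida mu hm u) := by
  obtain ⟨x, rfl⟩ := hB.exists_eq_shift hm u
  have h : B.shift mu x = B.shift lam x + (mu - lam) • (x : X) := by
    simp only [shift_apply]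
    module
  rw [yosida_shift, h, _root_.map_add, yosida_shift, _root_.map_smul, _root_.map_smul]
  module

/-- Exchanging `λ` and `μ` changes the sign of the left side of the resolvent identity, so the two
products agree after multiplication by `λ - μ`. -/
theorem commute_yosida (hB : B.IsMAccretive) {lam mu : ℝ} (hl : 0 < lam) (hm : 0 < mu) :
    Commute (hB.yosida lam hl) (hB.yosida mu hm) := by
  rcases eq_or_ne lam mu with rfl | hne
  · exact Commute.refl _
  ext u
  have h1 := hB.smul_yosida_sub_smul_yosida hl hm u
  have h2 := hB.smul_yosida_sub_smul_yosida hm hl u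
  rw [← neg_sub, h1, ← neg_smul, neg_sub] at h2
  exact smul_right_injective X (sub_ne_zero.2 hne) h2

theorem tendsto_yosida (hB : B.IsMAccretive) {lam : ℕ → ℝ} (hl : ∀ n, 0 < lam n)
    (hlim : Tendsto lam atTop atTop) (u : X) :
    Tendsto (fun n => hB.yosida (lam n) (hl n) u) atTop (𝓝 u) := by
  refine tendsto_apply_of_dense (fun n => hB.norm_yosida_le (hl n)) hB.1 (fun x hx => ?_) u
  rw [tendsto_iff_norm_sub_tendsto_zero]
  refine squeeze_zero (fun _ => norm_nonneg _) (fun n => ?_)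
    (by simpa using (tendsto_inv_atTop_zero.comp hlim).mul_const ‖B ⟨x, hx⟩‖)
  have h := congrArg norm (hB.smul_yosida_sub (hl n) ⟨x, hx⟩)
  rw [norm_smul, norm_neg, Real.norm_of_nonneg (hl n).le] at h
  have h1 := (hB.yosida (lam n) (hl n)).le_of_opNorm_le (hB.norm_yosida_le (hl n)) (B ⟨x, hx⟩)
  rw [← h, one_mul] at h1
  rw [inv_mul_eq_div, le_div_iff₀' (hl n)]
  exact h1

/-- The **Hille–Yosida theorem** for contraction semigroups. If the resolvents map a closed cone to
itself then so does the semigroup. -/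
theorem exists_semigroup [CompleteSpace X] (hB : B.IsMAccretive) {C : PointedCone ℝ X}
    (hC : _root_.IsClosed (C : Set X))
    (hBC : ∀ lam : ℝ, 0 < lam → ∀ h : Function.Bijective (B.shift lam), ∀ u ∈ C,
      (B.resolvent lam h u : X) ∈ C) :
    ∃ T : ℝ≥0 → X →L[ℝ] X, IsC0Semigroup T ∧ IsContractive T ∧ IsGenerator T (-B) ∧
      ∀ t, ∀ u ∈ C, T t u ∈ C := by
  have hl : ∀ n : ℕ, (0 : ℝ) < n + 1 := fun n => by positivity
  have hlim : Tendsto (fun n : ℕ => (n : ℝ) + 1) atTop atTop :=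
    tendsto_atTop_add_const_right _ _ tendsto_natCast_atTop_atTop
  set J : ℕ → X →L[ℝ] X := fun n => hB.yosida _ (hl n) with hJ
  set A : ℕ → X →L[ℝ] X := fun n => ((n : ℝ) + 1) • (J n - 1) with hA
  have hsmul : ∀ (t : ℝ) n, t • A n = (t * (n + 1)) • (J n - 1) := fun t n => by
    rw [hA, smul_smul]
  have hnorm : ∀ n, ∀ t : ℝ, 0 ≤ t → ‖NormedSpace.exp (t • A n)‖ ≤ 1 := fun n t ht => by
    rw [hsmul]
    exact norm_exp_smul_sub_one_le (hB.norm_yosida_le (hl n)) (by positivity)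
  have hcomm : ∀ n m, Commute (A n) (A m) := fun n m =>
    ((((hB.commute_yosida (hl n) (hl m)).sub_left (Commute.one_left _)).sub_right
      (Commute.one_right _)).smul_left _).smul_right _
  have hlimA : ∀ x : B.domain, Tendsto (fun n => A n x) atTop (𝓝 (-(B x))) := fun x => by
    refine (hB.tendsto_yosida hl hlim (B x)).neg.congr fun n => ?_
    rw [← hB.smul_yosida_sub (hl n) x]
    rfl
  have hex : ∀ t : ℝ≥0, ∃ T : X →L[ℝ] X, ∀ x,
      Tendsto (fun n => NormedSpace.exp ((t : ℝ) • A n) x) atTop (𝓝 (T x)) := by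
    intro t
    -- On the domain `A n x` converges, and `norm_exp_sub_exp_le` passes the Cauchy property to the
    -- exponentials; density and contractivity do the rest.
    have hcau : ∀ x, CauchySeq fun n => NormedSpace.exp ((t : ℝ) • A n) x := by
      refine cauchySeq_apply_of_dense (fun n => hnorm n t t.2) hB.1 fun x hx => ?_
      have h1 := (hlimA ⟨x, hx⟩).cauchySeq
      rw [Metric.cauchySeq_iff] at h1 ⊢
      intro ε hε
      obtain ⟨N, hN⟩ := h1 (ε / (t + 1)) (by positivity)
      refine ⟨N, fun m hm n hn => ?_⟩
      have h2 := hN m hm n hn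
      rw [dist_eq_norm] at h2 ⊢
      refine (norm_exp_sub_exp_le (hcomm m n) (hnorm m) (hnorm n) t.2 x).trans_lt ?_
      rw [lt_div_iff₀ (by positivity)] at h2
      refine lt_of_le_of_lt ?_ h2
      exact mul_le_mul_of_nonneg_left (by simp) (norm_nonneg _)
    choose f hf using fun x => cauchySeq_tendsto_of_complete (hcau x)
    exact ⟨continuousLinearMapOfTendsto _ (tendsto_pi_nhds.2 hf), hf⟩
  choose T hT using hex
  have hTc : IsContractive T := fun t => by
    refine ContinuousLinearMap.opNorm_le_bound _ zero_le_one fun x => ?_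
    exact le_of_tendsto (hT t x).norm
      (Eventually.of_forall fun n => ContinuousLinearMap.le_of_opNorm_le _ (hnorm n t t.2) x)
  have hT0 : T 0 = ContinuousLinearMap.id ℝ X := by
    ext x
    refine tendsto_nhds_unique (hT 0 x) ?_
    simp [NormedSpace.exp_zero]
  have hTS : IsC0Semigroup T := by
    refine ⟨hT0, fun s t => ?_, ?_⟩
    · ext x
      refine tendsto_nhds_unique (hT (s + t) x) ?_
      refine (tendsto_apply_apply (fun n => hnorm n s s.2) (hT t x) (hT s (T t x))).congr fun n => ?_
      rw [← exp_add_apply, ← add_smul]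
      · rfl
      · exact ((Commute.refl (A n)).smul_left _).smul_right _
    · refine tendsto_apply_of_dense hTc hB.1 fun x hx => ?_
      rw [tendsto_iff_norm_sub_tendsto_zero]
      have h1 : ∀ t : ℝ≥0, ‖T t x - x‖ ≤ ‖-(B ⟨x, hx⟩)‖ * t := fun t => by
        refine le_of_tendsto_of_tendsto ((hT t x).sub_const x).norm
          ((hlimA ⟨x, hx⟩).norm.mul_const _) (Eventually.of_forall fun n => ?_)
        -- Comparison with the zero generator bounds the displacement linearly in `t`.
        have h2 := norm_exp_sub_exp_le (Commute.zero_right (A n)) (hnorm n) (fun s _ => by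
          rw [smul_zero, NormedSpace.exp_zero]; exact ContinuousLinearMap.norm_id_le) t.2 x
        simpa [NormedSpace.exp_zero] using h2
      refine squeeze_zero (fun _ => norm_nonneg _) h1 ?_
      have h3 : Continuous fun t : ℝ≥0 => ‖-(B ⟨x, hx⟩)‖ * (t : ℝ) := by fun_prop
      have h4 := (h3.tendsto 0).mono_left (nhdsWithin_le_nhds (s := Set.Ioi 0))
      rwa [NNReal.coe_zero, mul_zero] at h4
  have hgen : ∀ x : B.domain,
      Tendsto (fun t : ℝ≥0 => (t : ℝ)⁻¹ • (T t (x : X) - x)) (𝓝[>] 0) (𝓝 (-(B x))) := by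
    intro x
    -- The integrated equation `T_t x - x = ∫₀ᵗ T_s (-B x) ds` survives the limit by dominated
    -- convergence. The trivial factor `exp (-0 * s)` matches `hasDerivAt_integral` at `λ = 0`.
    have hint : ∀ t : ℝ≥0, T t (x : X) - x =
        ∫ s in (0 : ℝ)..t, Real.exp (-0 * s) • T s.toNNReal (-(B x)) := fun t => by
      refine tendsto_nhds_unique ((hT t x).sub_const (x : X)) ?_
      have h1 : ∀ n, ∫ s in (0 : ℝ)..t, NormedSpace.exp (s • A n) (A n x) =
          NormedSpace.exp ((t : ℝ) • A n) x - x := fun n => by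
        have hcont : Continuous fun s : ℝ => NormedSpace.exp (s • A n) (A n x) :=
          continuous_iff_continuousAt.2 fun s => (hasDerivAt_exp_smul_apply _ _ s).continuousAt
        rw [intervalIntegral.integral_eq_sub_of_hasDerivAt
          (fun s _ => hasDerivAt_exp_smul_apply (A n) x s) (hcont.intervalIntegrable _ _)]
        simp [NormedSpace.exp_zero]
      simp only [← h1]
      obtain ⟨M, hM⟩ := (hlimA x).norm.bddAbove_range
      refine intervalIntegral.tendsto_integral_filter_of_dominated_convergence (fun _ => M)
        (Eventually.of_forall fun n => ?_) (Eventually.of_forall fun n => ?_)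
        intervalIntegrable_const ?_
      · have hcont : Continuous fun s : ℝ => NormedSpace.exp (s • A n) (A n x) :=
          continuous_iff_continuousAt.2 fun s => (hasDerivAt_exp_smul_apply _ _ s).continuousAt
        exact hcont.aestronglyMeasurable
      · refine Eventually.of_forall fun s hs => ?_
        rw [Set.uIoc_of_le t.coe_nonneg] at hs
        refine (ContinuousLinearMap.le_of_opNorm_le _ (hnorm n s hs.1.le) _).trans ?_
        rw [one_mul]
        exact hM ⟨n, rfl⟩
      · refine Eventually.of_forall fun s hs => ?_
        rw [Set.uIoc_of_le t.coe_nonneg] at hs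
        have h2 := hT s.toNNReal (-(B x))
        rw [Real.coe_toNNReal s hs.1.le] at h2
        simpa using tendsto_apply_apply (fun n => hnorm n s hs.1.le) (hlimA x) h2
    have h3 := IsC0Semigroup.tendsto_inv_smul (hTS.hasDerivAt_integral hTc 0 (-(B x)) 0)
    simp only [intervalIntegral.integral_same, sub_zero, ← hint, mul_zero, Real.exp_zero,
      Real.toNNReal_zero, hTS.apply_zero, one_smul] at h3
    exact h3
  refine ⟨T, hTS, hTc, fun u v => ⟨fun h => ?_, fun h => ?_⟩, fun t u hu => ?_⟩
  · obtain ⟨x, rfl, hx⟩ := LinearPMap.mem_neg_graph.1 h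
    rw [← neg_neg v, ← hx]
    exact hgen x
  -- The generator cannot properly extend `-B`: with `(I + B) x = u - v`, the vector `u - x` is
  -- annihilated by identity minus generator, so dissipativity forces `u = x`.
  · obtain ⟨x, hx⟩ := hB.exists_eq_shift one_pos (u - v)
    have h1 : Tendsto (fun t : ℝ≥0 => (t : ℝ)⁻¹ • (T t (u - x) - (u - x))) (𝓝[>] 0)
        (𝓝 (v - -(B x))) := by
      refine (h.sub (hgen x)).congr fun t => ?_
      rw [_root_.map_sub]
      module
    have h2 := IsC0Semigroup.mul_norm_le_of_tendsto hTc one_pos h1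
    rw [shift_apply, one_smul] at hx
    have h3 : (1 : ℝ) • (u - (x : X)) - (v - -(B x)) = 0 := by
      rw [one_smul, sub_neg_eq_add, sub_sub, ← add_assoc, add_comm (x : X), add_assoc, hx]
      abel
    rw [h3, norm_zero, one_mul] at h2
    have h4 : u = x := sub_eq_zero.1 (norm_le_zero_iff.1 h2)
    refine LinearPMap.mem_neg_graph.2 ⟨x, h4.symm, ?_⟩
    rw [h4] at hx
    exact add_left_cancel (hx.trans (sub_eq_add_neg _ _))
  · refine hC.mem_of_tendsto (hT t u) (Eventually.of_forall fun n => ?_)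
    rw [SetLike.mem_coe, hsmul]
    exact exp_smul_sub_one_mem hC (fun w hw => C.smul_mem (hl n).le (hBC _ (hl n) _ w hw))
      (by positivity) hu

end LinearPMap.IsMAccretive

section

variable {X : Type*} [NormedAddCommGroup X] [NormedSpace ℝ X]

/-! ### Rescaling of semigroups -/

theorem IsC0Semigroup.rescale {T : ℝ≥0 → X →L[ℝ] X} (hT : IsC0Semigroup T) (ω : ℝ) :
    IsC0Semigroup fun t => Real.exp (ω * t) • T t where
  zero := by simp [hT.zero]
  add s t := by
    ext u
    simp only [smul_apply, ContinuousLinearMap.comp_apply, map_smul, hT.apply_add, smul_smul,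
      ← Real.exp_add, NNReal.coe_add, mul_add]
    rw [add_comm (ω * (s : ℝ))]
  tendsto u := by
    have h : Tendsto (fun t : ℝ≥0 => Real.exp (ω * t)) (𝓝[>] 0) (𝓝 1) := by
      have h1 : Continuous fun t : ℝ≥0 => Real.exp (ω * t) := by fun_prop
      simpa using (h1.tendsto 0).mono_left (nhdsWithin_le_nhds (s := Set.Ioi 0))
    simpa using h.smul (hT.tendsto u)

theorem tendsto_rescale {T : ℝ≥0 → X →L[ℝ] X} (ω : ℝ) {u v : X}
    (h : Tendsto (fun t : ℝ≥0 => (t : ℝ)⁻¹ • (T t u - u)) (𝓝[>] 0) (𝓝 v)) :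
    Tendsto (fun t : ℝ≥0 => (t : ℝ)⁻¹ • ((Real.exp (ω * t) • T t) u - u)) (𝓝[>] 0)
      (𝓝 (v + ω • u)) := by
  have h1 : Tendsto (fun t : ℝ≥0 => Real.exp (ω * t)) (𝓝[>] 0) (𝓝 1) := by
    have h1 : Continuous fun t : ℝ≥0 => Real.exp (ω * t) := by fun_prop
    simpa using (h1.tendsto 0).mono_left (nhdsWithin_le_nhds (s := Set.Ioi 0))
  have h2 : HasDerivAt (fun t : ℝ => Real.exp (ω * t) • u) (ω • u) 0 := by
    have e : HasDerivAt (fun t : ℝ => Real.exp (ω * t)) ω 0 := by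
      simpa using ((hasDerivAt_id (0 : ℝ)).const_mul ω).exp
    exact e.smul_const u
  have h3 := (h1.smul h).add (IsC0Semigroup.tendsto_inv_smul h2)
  rw [one_smul] at h3
  refine h3.congr fun t => ?_
  rw [mul_zero, Real.exp_zero, one_smul, smul_apply]
  module

theorem IsGenerator.rescale {T : ℝ≥0 → X →L[ℝ] X} {L : X →ₗ.[ℝ] X} {ω : ℝ}
    (hT : IsGenerator T (-(⟨L.domain, L.shift ω⟩ : X →ₗ.[ℝ] X))) :
    IsGenerator (fun t => Real.exp (ω * t) • T t) (-L) := by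
  intro u v
  have h1 : (u, v) ∈ (-L).graph ↔
      (u, v - ω • u) ∈ (-(⟨L.domain, L.shift ω⟩ : X →ₗ.[ℝ] X)).graph := by
    rw [LinearPMap.mem_neg_graph, LinearPMap.mem_neg_graph]
    refine exists_congr fun x => and_congr_right fun hx => ?_
    change L x = -v ↔ ω • (x : X) + L x = -(v - ω • u)
    rw [hx, neg_sub, sub_eq_add_neg, add_right_inj]
  rw [h1, hT u (v - ω • u)]
  refine ⟨fun h => ?_, fun h => ?_⟩
  · simpa using tendsto_rescale ω h
  -- Rescaling by `-ω` undoes the factor and gives the converse.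
  · have h2 := tendsto_rescale (T := fun t : ℝ≥0 => Real.exp (ω * t) • T t) (-ω) h
    rw [neg_smul, ← sub_eq_add_neg] at h2
    refine h2.congr fun t => ?_
    rw [smul_smul, ← Real.exp_add, neg_mul, neg_add_cancel, Real.exp_zero, one_smul]

/-! ### Operators on spaces whose norm is a base norm -/

namespace IsBaseNormCone

variable {C : PointedCone ℝ X} {τ : X →ₗ[ℝ] ℝ}

theorem nonneg (hC : IsBaseNormCone C τ) {u : X} (hu : u ∈ C) : 0 ≤ τ u :=
  hC.norm_eq u hu ▸ norm_nonneg u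

theorem le_norm (hC : IsBaseNormCone C τ) (u : X) : τ u ≤ ‖u‖ := by
  obtain ⟨p, hp, q, hq, rfl, h⟩ := hC.exists_sub u
  rw [← h, map_sub, hC.norm_eq p hp]
  linarith [hC.nonneg hq, norm_nonneg q]

theorem continuous (hC : IsBaseNormCone C τ) : Continuous τ := by
  refine AddMonoidHomClass.continuous_of_bound τ 1 fun u => ?_
  rw [one_mul, Real.norm_eq_abs, abs_le]
  have := hC.le_norm (-u)
  rw [map_neg, norm_neg] at this
  exact ⟨by linarith, hC.le_norm u⟩

/-- Norms add across the decomposition, so a bound on the cone extends with the same constant;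
accretivity needs this sharpness. -/
theorem norm_map_le (hC : IsBaseNormCone C τ) {Y : Type*} [SeminormedAddCommGroup Y] [Module ℝ Y]
    (f : X →ₗ[ℝ] Y) {c : ℝ} (hf : ∀ u ∈ C, ‖f u‖ ≤ c * ‖u‖) (u : X) : ‖f u‖ ≤ c * ‖u‖ := by
  obtain ⟨p, hp, q, hq, rfl, h⟩ := hC.exists_sub u
  rw [← h, map_sub, mul_add]
  exact (norm_sub_le _ _).trans (add_le_add (hf p hp) (hf q hq))

/-- The negative of the generator of a positive contraction semigroup has nonnegative trace. -/
theorem map_generator_nonneg (hC : IsBaseNormCone C τ) {S : ℝ≥0 → X →L[ℝ] X} {H : X →ₗ.[ℝ] X}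
    (hG : IsGenerator S (-H)) (hc : IsContractive S) (x : H.domain) (hx : (x : X) ∈ C) :
    0 ≤ τ (H x) := by
  have h1 := (hC.continuous.tendsto _).comp (hG.tendsto x)
  have h2 : τ (-(H x)) ≤ 0 := by
    -- On the cone `τ (S t x) ≤ ‖S t x‖ ≤ ‖x‖ = τ x`, so every difference quotient has nonpositive
    -- trace.
    refine le_of_tendsto h1 (Eventually.of_forall fun t => ?_)
    rw [Function.comp_apply, map_smul, smul_eq_mul, map_sub, ← hC.norm_eq _ hx]
    refine mul_nonpos_of_nonneg_of_nonpos (by positivity) (sub_nonpos.2 ?_)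
    exact (hC.le_norm _).trans (IsC0Semigroup.norm_apply_le hc t _)
  rwa [map_neg, neg_nonpos] at h2

end IsBaseNormCone

/-! ### Positive perturbations -/

section Perturbation

variable {C : PointedCone ℝ X} {τ : X →ₗ[ℝ] ℝ} {H : X →ₗ.[ℝ] X} {K : H.domain →ₗ[ℝ] X}
  {lam kap a b : ℝ}

theorem pow_resolvent_mem (hK : ∀ x : H.domain, (x : X) ∈ C → K x ∈ C)
    {hH : Function.Bijective (H.shift lam)} (hR : ∀ u ∈ C, (H.resolvent lam hH u : X) ∈ C) (n : ℕ)
    {u : X} (hu : u ∈ C) : ((K ∘ₗ H.resolvent lam hH) ^ n : Module.End ℝ X) u ∈ C := by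
  induction n with
  | zero => exact hu
  | succ n ih =>
    rw [pow_succ']
    exact hK _ (hR _ ih)

/-- A telescoping sum: with `P = K R`, `λ + H` maps `R Pⁿ u` to `Pⁿ u` and `K` maps it to `Pⁿ⁺¹ u`.
-/
theorem shift_sum_resolvent (hH : Function.Bijective (H.shift lam)) (u : X) (N : ℕ) :
    H.shift lam (∑ n ∈ Finset.range N,
        H.resolvent lam hH (((K ∘ₗ H.resolvent lam hH) ^ n : Module.End ℝ X) u)) =
      u - ((K ∘ₗ H.resolvent lam hH) ^ N : Module.End ℝ X) u +
      K (∑ n ∈ Finset.range N,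
        H.resolvent lam hH (((K ∘ₗ H.resolvent lam hH) ^ n : Module.End ℝ X) u)) := by
  induction N with
  | zero => simp
  | succ N ih =>
    rw [Finset.sum_range_succ, map_add, map_add, ih, LinearPMap.shift_resolvent, pow_succ' _ N]
    simp only [Module.End.mul_apply, LinearMap.comp_apply]
    abel

/-- The total mass of the terms `(K (λ I + H)⁻¹)ⁿ u` is controlled by that of `u`. -/
theorem sum_norm_pow_resolvent_le (hC : IsBaseNormCone C τ)
    (hK : ∀ x : H.domain, (x : X) ∈ C → K x ∈ C) (ha : 0 ≤ a) (hb : 0 ≤ b) (hb1 : b < 1)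
    (hKH : ∀ x : H.domain, (x : X) ∈ C → τ (K x) ≤ a * τ x + b * τ (H x)) (hl : 0 < lam)
    (hkap : 0 < kap)
    (hL : ∀ x : H.domain, (x : X) ∈ C → kap * τ x ≤ lam * τ x + τ (H x) - τ (K x))
    {hH : Function.Bijective (H.shift lam)} (hR : ∀ u ∈ C, (H.resolvent lam hH u : X) ∈ C)
    {u : X} (hu : u ∈ C) (N : ℕ) :
    ∑ n ∈ Finset.range N, ‖((K ∘ₗ H.resolvent lam hH) ^ (n + 1) : Module.End ℝ X) u‖ ≤
      (a / kap + b) / (1 - b) * ‖u‖ := by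
  set P : Module.End ℝ X := K ∘ₗ H.resolvent lam hH with hP
  set s := ∑ n ∈ Finset.range N, H.resolvent lam hH ((P ^ n) u) with hs
  have hPC : ∀ n, (P ^ n) u ∈ C := fun n => pow_resolvent_mem hK hR n hu
  have hsC : (s : X) ∈ C := by
    rw [hs, AddSubmonoidClass.coe_finsetSum]
    exact C.sum_mem fun n _ => hR _ (hPC n)
  -- All terms are positive, so the sum of norms is a single trace, to which the relative bound
  -- applies.
  have h1 : τ (K s) = ∑ n ∈ Finset.range N, ‖(P ^ (n + 1)) u‖ := by
    rw [hs, map_sum, map_sum]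
    refine Finset.sum_congr rfl fun n _ => ?_
    rw [hC.norm_eq _ (hPC _), pow_succ']
    rfl
  have h2 := congrArg τ (shift_sum_resolvent (K := K) hH u N)
  rw [← hP, ← hs, LinearPMap.shift_apply, map_add, map_add, map_sub, map_smul, smul_eq_mul] at h2
  have h3 := hL s hsC
  have h4 := hKH s hsC
  have h5 := hC.nonneg (hPC N)
  have h6 := mul_nonneg hl.le (hC.nonneg hsC)
  -- Combine `hL` with the trace of the telescoped identity and drop `τ (Pᴺ u) ≥ 0`.
  have h7 : τ s ≤ τ u / kap := by
    rw [le_div_iff₀' hkap]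
    linarith
  have h8 : a * τ s ≤ a * (τ u / kap) := mul_le_mul_of_nonneg_left h7 ha
  -- Here `λ τ s` is dropped as well. The term `b τ (K s)` is absorbed on the left, whence the
  -- denominator `1 - b`.
  have h9 : b * τ (H s) ≤ b * (τ u + τ (K s)) := mul_le_mul_of_nonneg_left (by linarith) hb
  have h10 : a * (τ u / kap) = a / kap * τ u := by ring
  rw [← h1, hC.norm_eq u hu, div_mul_eq_mul_div, le_div_iff₀ (by linarith)]
  linarith

variable [CompleteSpace X]

/-- Let `H` have a positive resolvent at `λ`, and let `K` be positive and dominated by `H` in trace.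
Then `λ I + H - K` is invertible, its inverse is positive, and it is the sum of the perturbation
series. -/
theorem exists_resolvent_sub (hC : IsBaseNormCone C τ)
    (hK : ∀ x : H.domain, (x : X) ∈ C → K x ∈ C) (ha : 0 ≤ a) (hb : 0 ≤ b) (hb1 : b < 1)
    (hKH : ∀ x : H.domain, (x : X) ∈ C → τ (K x) ≤ a * τ x + b * τ (H x)) (hl : 0 < lam)
    (hkap : 0 < kap)
    (hL : ∀ x : H.domain, (x : X) ∈ C → kap * τ x ≤ lam * τ x + τ (H x) - τ (K x))
    (hH : Function.Bijective (H.shift lam)) (hR : ∀ u ∈ C, (H.resolvent lam hH u : X) ∈ C)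
    {c : ℝ} (hRn : ∀ u, ‖(H.resolvent lam hH u : X)‖ ≤ c * ‖u‖)
    {L : X →ₗ.[ℝ] X} (hLdef : L = ⟨H.domain, H.toFun - K⟩) :
    ∃ h : Function.Bijective (L.shift lam),
      (∀ u, ‖(L.resolvent lam h u : X)‖ ≤ kap⁻¹ * ‖u‖) ∧
      (∀ u ∈ C, (L.resolvent lam h u : X) ∈ C) ∧
      ∀ u, Tendsto (fun N : ℕ => ∑ n ∈ Finset.range (N + 1),
        (H.resolvent lam hH (((K ∘ₗ H.resolvent lam hH) ^ n : Module.End ℝ X) u) : X)) atTop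
        (𝓝 (L.resolvent lam h u : X)) := by
  subst hLdef
  set L : X →ₗ.[ℝ] X := ⟨H.domain, H.toFun - K⟩
  have hshift : ∀ x : H.domain, L.shift lam x = H.shift lam x - K x := fun x =>
    (add_sub_assoc _ _ _).symm
  set P : Module.End ℝ X := K ∘ₗ H.resolvent lam hH with hP
  have hsumC : ∀ u ∈ C, Summable fun n => ‖(P ^ n) u‖ := fun u hu =>
    (summable_nat_add_iff 1).1 (summable_of_sum_range_le (fun _ => norm_nonneg _)
      (sum_norm_pow_resolvent_le hC hK ha hb hb1 hKH hl hkap hL hR hu))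
  have hsum : ∀ u, Summable fun n => ‖(P ^ n) u‖ := fun u => by
    obtain ⟨p, hp, q, hq, rfl, -⟩ := hC.exists_sub u
    refine Summable.of_nonneg_of_le (fun _ => norm_nonneg _) (fun n => ?_)
      ((hsumC p hp).add (hsumC q hq))
    rw [map_sub]
    exact norm_sub_le _ _
  -- The case `N = 1` bounds `P` on the cone, so `P` is continuous although no continuity of `K` is
  -- assumed. The constant may exceed `1`.
  have hPn : ∀ u, ‖P u‖ ≤ (a / kap + b) / (1 - b) * ‖u‖ := hC.norm_map_le P fun u hu => by
    simpa [hP] using sum_norm_pow_resolvent_le hC hK ha hb hb1 hKH hl hkap hL hR hu 1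
  let Pc : X →L[ℝ] X := P.mkContinuous _ hPn
  let Rc : X →L[ℝ] X := (H.domain.subtype ∘ₗ H.resolvent lam hH).mkContinuous _ hRn
  have hy : ∀ u, L.shift lam (H.resolvent lam hH (∑' n, (P ^ n) u)) = u := fun u => by
    have hs := (hsum u).of_norm
    have h1 : P (∑' n, (P ^ n) u) = ∑' n, (P ^ (n + 1)) u := by
      have h2 := Pc.map_tsum hs
      simp only [pow_succ']
      exact h2
    rw [hshift, LinearPMap.shift_resolvent]
    change _ - P _ = _
    rw [h1, hs.tsum_eq_zero_add, add_sub_cancel_right]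
    rfl
  -- A kernel element `x` makes `(λ + H) x` a fixed point of `P`; a constant sequence with summable
  -- norms vanishes.
  have hinj : Function.Injective (L.shift lam) := by
    refine (injective_iff_map_eq_zero _).2 fun x hx => ?_
    rw [hshift x, sub_eq_zero] at hx
    have hPv : P (H.shift lam x) = H.shift lam x := by
      change K (H.resolvent lam hH (H.shift lam x)) = _
      rw [LinearPMap.resolvent_shift, hx]
    have hPv' : ∀ n, (P ^ n) (H.shift lam x) = H.shift lam x := fun n => by
      induction n with
      | zero => rfl
      | succ n ih => rw [pow_succ', Module.End.mul_apply, ih, hPv]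
    have h0 := (hsum (H.shift lam x)).tendsto_atTop_zero
    simp only [hPv'] at h0
    have h1 := norm_eq_zero.1 (tendsto_nhds_unique tendsto_const_nhds h0)
    exact hH.1 (h1.trans (map_zero _).symm)
  have hbij : Function.Bijective (L.shift lam) := ⟨hinj, fun u => ⟨_, hy u⟩⟩
  have hres : ∀ u, L.resolvent lam hbij u = H.resolvent lam hH (∑' n, (P ^ n) u) := fun u =>
    hinj (by rw [hy, LinearPMap.shift_resolvent])
  have hpos : ∀ u ∈ C, (L.resolvent lam hbij u : X) ∈ C := fun u hu => by
    rw [hres]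
    exact hR _ (hC.isClosed.mem_of_tendsto (hsum u).of_norm.hasSum
      (Eventually.of_forall fun s => C.sum_mem fun n _ => pow_resolvent_mem hK hR n hu))
  refine ⟨hbij, ?_, hpos, fun u => ?_⟩
  -- It suffices to take `u` in the cone. Its image `v` is positive too, so `κ ‖v‖ = κ τ v ≤ τ ((λ +
  -- L) v) = ‖u‖`.
  · refine hC.norm_map_le (L.domain.subtype ∘ₗ L.resolvent lam hbij) fun u hu => ?_
    change ‖(L.resolvent lam hbij u : X)‖ ≤ _
    have h1 := hL _ (hpos u hu)
    have h2 := congrArg τ (L.shift_resolvent lam hbij u)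
    rw [hshift, LinearPMap.shift_apply, map_sub, map_add, map_smul, smul_eq_mul] at h2
    rw [inv_mul_eq_div, le_div_iff₀' hkap, hC.norm_eq u hu, hC.norm_eq _ (hpos u hu)]
    linarith
  · rw [hres]
    exact (tendsto_add_atTop_iff_nat 1).2 (Rc.hasSum (hsum u).of_norm.hasSum).tendsto_sum_nat

/-- Positive perturbations of generators of positive contraction semigroups. -/
theorem perturbation_of_generator (hC : IsBaseNormCone C τ) {S : ℝ≥0 → X →L[ℝ] X}
    (hS : IsC0Semigroup S) (hSc : IsContractive S) (hSC : ∀ t, ∀ u ∈ C, S t u ∈ C)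
    (hG : IsGenerator S (-H)) (hK : ∀ x : H.domain, (x : X) ∈ C → K x ∈ C) (ha : 0 ≤ a)
    (hb : 0 ≤ b) (hb1 : b < 1)
    (hKH : ∀ x : H.domain, (x : X) ∈ C → τ (K x) ≤ a * τ x + b * τ (H x)) (hl : 0 < lam)
    (hkap : 0 < kap)
    (hL : ∀ x : H.domain, (x : X) ∈ C → kap * τ x ≤ lam * τ x + τ (H x) - τ (K x))
    {L : X →ₗ.[ℝ] X} (hLdef : L = ⟨H.domain, H.toFun - K⟩) :
    ∃ (hH : Function.Bijective (H.shift lam)) (h : Function.Bijective (L.shift lam)),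
      (∀ u, ‖(L.resolvent lam h u : X)‖ ≤ kap⁻¹ * ‖u‖) ∧
      (∀ u ∈ C, (L.resolvent lam h u : X) ∈ C) ∧
      ∀ u, Tendsto (fun N : ℕ => ∑ n ∈ Finset.range (N + 1),
        (H.resolvent lam hH (((K ∘ₗ H.resolvent lam hH) ^ n : Module.End ℝ X) u) : X)) atTop
        (𝓝 (L.resolvent lam h u : X)) :=
  have hH := hG.bijective_shift hS hSc hl
  ⟨hH, exists_resolvent_sub hC hK ha hb hb1 hKH hl hkap hL hH
    (fun _ hu => hG.resolvent_mem hS hSc hC.isClosed hSC hl hH hu)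
    (LinearPMap.norm_resolvent_le hl hH (hG.mul_norm_le hSc hl)) hLdef⟩

end Perturbation

end

/-! ### Application to self-adjoint trace-class operators. -/

theorem proposition2p4 {E : Type*} [NormedAddCommGroup E] [InnerProductSpace ℂ E] [CompleteSpace E]
    (H : TraceClassSA E →ₗ.[ℝ] TraceClassSA E)
    (hH : ∃ S : ℝ≥0 → TraceClassSA E →L[ℝ] TraceClassSA E,
      IsC0Semigroup S ∧ IsContractive S ∧ IsPositivityPreservingSemigroup S ∧ IsGenerator S (-H))
    (K : H.domain →ₗ[ℝ] TraceClassSA E) (hK : IsPositivityPreserving K)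
    (a b : ℝ) (ha : 0 ≤ a) (hb : 0 ≤ b) (hb1 : b < 1)
    (hKH : ∀ u : H.domain, (u : TraceClassSA E).Nonneg →
      (K u).trace ≤ a * (u : TraceClassSA E).trace + b * (H u).trace)
    (L : TraceClassSA E →ₗ.[ℝ] TraceClassSA E) (hL : L = ⟨H.domain, H.toFun - K⟩) :
    L.IsQuasiMAccretive ∧
    ∃ T : ℝ≥0 → TraceClassSA E →L[ℝ] TraceClassSA E,
      IsC0Semigroup T ∧ IsGenerator T (-L) ∧ IsPositivityPreservingSemigroup T ∧
      ((∀ u : H.domain, (u : TraceClassSA E).Nonneg → (K u).trace ≤ (H u).trace) →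
        L.IsMAccretive ∧ IsContractive T ∧
        ∀ lam : ℝ, 0 < lam →
          ∃ (hlamH : Function.Bijective (H.shift lam)) (hlamL : Function.Bijective (L.shift lam)),
            ∀ u : TraceClassSA E,
              Tendsto
                (fun N : ℕ => ∑ n ∈ Finset.range (N + 1),
                  (H.resolvent lam hlamH
                    (((K ∘ₗ H.resolvent lam hlamH) ^ n : Module.End ℝ (TraceClassSA E)) u) :
                      TraceClassSA E))
                atTop (𝓝 (L.resolvent lam hlamL u : TraceClassSA E))) := by
  obtain ⟨S, hS, hSc, hSC, hG⟩ := hH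
  have hC := TraceClassSA.isBaseNormCone (E := E)
  have hpert := fun lam kap hl hkap hLk => perturbation_of_generator (C := TraceClassSA.nonnegCone E)
    (lam := lam) (kap := kap) hC hS hSc hSC hG hK ha hb hb1 hKH hl hkap hLk hL
  have hdense : Dense (L.domain : Set (TraceClassSA E)) := by
    rw [hL]
    exact hG.dense_domain hS hSc
  have hshift : ∀ lam, (⟨L.domain, L.shift a⟩ : TraceClassSA E →ₗ.[ℝ] _).shift lam =
      L.shift (lam + a) := fun lam => by
    ext1 x
    change lam • (x : TraceClassSA E) + (a • (x : TraceClassSA E) + L x) = (lam + a) • _ + L x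
    rw [add_smul, add_assoc]
    rfl
  have hquasi : ∀ lam : ℝ, 0 < lam →
      ∃ h : Function.Bijective ((⟨L.domain, L.shift a⟩ : TraceClassSA E →ₗ.[ℝ] _).shift lam),
        (∀ u, ‖((⟨L.domain, L.shift a⟩ : TraceClassSA E →ₗ.[ℝ] _).resolvent lam h u :
          TraceClassSA E)‖ ≤ lam⁻¹ * ‖u‖) ∧
        ∀ u ∈ TraceClassSA.nonnegCone E,
          ((⟨L.domain, L.shift a⟩ : TraceClassSA E →ₗ.[ℝ] _).resolvent lam h u :
            TraceClassSA E) ∈ TraceClassSA.nonnegCone E := fun lam hl => by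
    -- At `λ + a` the constant `κ = λ` is admissible: `a Tr x + Tr (H x) - Tr (K x) ≥ (1 - b) Tr (H
    -- x) ≥ 0`.
    obtain ⟨-, h, hn, hpos, -⟩ := hpert (lam + a) lam (by linarith) hl fun x hx => by
      have h1 := hKH x hx
      have h2 := hC.map_generator_nonneg hG hSc x hx
      have h3 := mul_nonneg (sub_nonneg.2 hb1.le) h2
      simp only [TraceClassSA.traceₗ_apply] at *
      linarith
    have hbij := h
    rw [← hshift lam] at hbij
    have hres : ∀ u, (⟨L.domain, L.shift a⟩ : TraceClassSA E →ₗ.[ℝ] _).resolvent lam hbij u =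
        L.resolvent (lam + a) h u := fun u => hbij.1 (by
      rw [LinearPMap.shift_resolvent, hshift lam]
      exact (L.shift_resolvent (lam + a) h u).symm)
    exact ⟨hbij, fun u => by rw [hres]; exact hn u, fun u hu => by rw [hres]; exact hpos u hu⟩
  have hB : (⟨L.domain, L.shift a⟩ : TraceClassSA E →ₗ.[ℝ] _).IsMAccretive :=
    ⟨hdense, fun lam hl => (hquasi lam hl).imp fun _ h => h.1⟩
  refine ⟨⟨a, hB⟩, ?_⟩
  -- One semigroup must serve all claims. If the extra inequality holds, it is built from `L`
  -- directly and is contractive; otherwise it is built from `a + L` and rescaled, and the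
  -- conditional claims are vacuous. Uniqueness of semigroups is thus not needed.
  by_cases hKH' : ∀ u : H.domain, (u : TraceClassSA E).Nonneg → (K u).trace ≤ (H u).trace
  · have hpert' := fun lam (hl : 0 < lam) => hpert lam lam hl hl fun x hx => by
      have h1 := hKH' x hx
      simp only [TraceClassSA.traceₗ_apply]
      linarith
    have hLm : L.IsMAccretive := ⟨hdense, fun lam hl => by
      obtain ⟨-, h, hn, -⟩ := hpert' lam hl
      exact ⟨h, hn⟩⟩
    obtain ⟨T, hT, hTc, hTG, hTC⟩ := hLm.exists_semigroup hC.isClosed fun lam hl _ => by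
      obtain ⟨-, _, -, hpos, -⟩ := hpert' lam hl
      exact hpos
    refine ⟨T, hT, hTG, hTC, fun _ => ⟨hLm, hTc, fun lam hl => ?_⟩⟩
    obtain ⟨h1, h2, -, -, h3⟩ := hpert' lam hl
    exact ⟨h1, h2, h3⟩
  · obtain ⟨T, hT, -, hTG, hTC⟩ := hB.exists_semigroup hC.isClosed fun lam hl _ =>
      (hquasi lam hl).choose_spec.2
    exact ⟨fun t => Real.exp (a * t) • T t, hT.rescale a, hTG.rescale,
      fun t u hu => (TraceClassSA.nonnegCone E).smul_mem (Real.exp_pos _).le (hTC t u hu),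
      fun h => absurd h hKH'⟩
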